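/- Let $B\subseteq\mathbb{C}^2$ be a connected set containing $\mathbb{C}\times\{-2\}$, with coordinates $(z,\delta)$ on $\mathbb{C}^2$. Let $\mathcal{M}=\mathcal{M}_{z,\delta}(B)$ be the field of functions meromorphic on an open superset of $B$, where two such functions are identified if they agree, as meromorphic functions, on some open superset of $B$. Let $\mathcal{H}\subseteq\mathcal{M}$ be the ring of those elements that are analytic on an open superset of $B$. If $x,y\in\mathcal{M}$ satisfy $$(z^3+\delta z^2+z)\,y^2=x^3+\delta x^2+x$$ in $\mathcal{M}$ and $y\neq 0$, then $x_z/y\in\mathcal{H}$, where $x_z=\partial x/\partial z$. -/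

import Mathlib

open Filter Topology

noncomputable section

namespace ManinDenef

/-- Properties which hold *generically near `B`*: those that hold on an open set `D` which is dense
in some open superset `U` of `B`. Points of `ℂ × ℂ` are written `(z, δ)`. -/
def genericNhds (B : Set (ℂ × ℂ)) : Filter (ℂ × ℂ) where
  sets := {S | ∃ U D : Set (ℂ × ℂ), IsOpen U ∧ B ⊆ U ∧ IsOpen D ∧ D ⊆ S ∧ U ⊆ closure D}
  univ_sets := ⟨Set.univ, Set.univ, isOpen_univ, Set.subset_univ _, isOpen_univ,
    Set.subset_univ _, subset_closure⟩
  sets_of_superset := by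
    rintro S T ⟨U, D, hU, hBU, hD, hDS, hUD⟩ hST
    exact ⟨U, D, hU, hBU, hD, hDS.trans hST, hUD⟩
  inter_sets := by
    rintro S T ⟨U, D, hU, hBU, hD, hDS, hUD⟩ ⟨V, E, hV, hBV, hE, hET, hVE⟩
    refine ⟨U ∩ V, D ∩ E, hU.inter hV, Set.subset_inter hBU hBV, hD.inter hE,
      Set.inter_subset_inter hDS hET, ?_⟩
    rintro p ⟨hpU, hpV⟩
    rw [mem_closure_iff]
    intro O hO hpO
    obtain ⟨q, ⟨hqO, hqV⟩, hqD⟩ :=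
      mem_closure_iff.1 (hUD hpU) (O ∩ V) (hO.inter hV) ⟨hpO, hpV⟩
    obtain ⟨r, ⟨hrO, hrD⟩, hrE⟩ :=
      mem_closure_iff.1 (hVE hqV) (O ∩ D) (hO.inter hD) ⟨hqO, hqD⟩
    exact ⟨r, hrO, hrD, hrE⟩

/-- Complex functions, identified when they agree generically near `B`. This is a commutative ring
under the pointwise operations, and `⁻¹` and `/` are pointwise too. If `B` is connected, a nonzero
meromorphic function is generically nonzero near `B`, so that `⁻¹` is its inverse in the ring. -/
abbrev FunGerm (B : Set (ℂ × ℂ)) : Type := Germ (genericNhds B) ℂ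

/-- The function `f` represents a meromorphic function near `p`: there are analytic functions
`g`, `h` near `p`, where `h` is not identically zero near `p`, such that `f = g / h` wherever
`h ≠ 0`. (At the zeros of `h` the value of `f` is irrelevant.) -/
def IsMeromorphicAt (f : ℂ × ℂ → ℂ) (p : ℂ × ℂ) : Prop :=
  ∃ g h : ℂ × ℂ → ℂ, AnalyticAt ℂ g p ∧ AnalyticAt ℂ h p ∧ (∃ᶠ q in 𝓝 p, h q ≠ 0) ∧
    ∀ᶠ q in 𝓝 p, h q ≠ 0 → f q = g q / h q

/-- `𝓜_{z,δ}(B)`: the meromorphic functions on an open superset of `B`. Two of them are equal if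
and only if they agree, as meromorphic functions, on some open superset of `B`. -/
def Mero (B : Set (ℂ × ℂ)) : Set (FunGerm B) :=
  {x | ∃ (U : Set (ℂ × ℂ)) (f : ℂ × ℂ → ℂ), IsOpen U ∧ B ⊆ U ∧
    (∀ p ∈ U, IsMeromorphicAt f p) ∧ x = (f : FunGerm B)}

/-- `𝓗_{z,δ}(B)`: the functions which are analytic on an open superset of `B`. -/
def Hol (B : Set (ℂ × ℂ)) : Set (FunGerm B) :=
  {x | ∃ (U : Set (ℂ × ℂ)) (f : ℂ × ℂ → ℂ), IsOpen U ∧ B ⊆ U ∧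
    AnalyticOnNhd ℂ f U ∧ x = (f : FunGerm B)}

/-- The coordinate function `z`. -/
def zCoord (B : Set (ℂ × ℂ)) : FunGerm B := ((fun p => p.1 : ℂ × ℂ → ℂ) : FunGerm B)

/-- The coordinate function `δ`. -/
def δCoord (B : Set (ℂ × ℂ)) : FunGerm B := ((fun p => p.2 : ℂ × ℂ → ℂ) : FunGerm B)

/-- The partial derivative `f_z` of a function `f` of `(z, δ)`. -/
def partialZ (f : ℂ × ℂ → ℂ) (p : ℂ × ℂ) : ℂ := deriv (fun w => f (w, p.2)) p.1

theorem partialZ_congr (B : Set (ℂ × ℂ)) {f g : ℂ × ℂ → ℂ} (hfg : f =ᶠ[genericNhds B] g) :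
    partialZ f =ᶠ[genericNhds B] partialZ g := by
  obtain ⟨U, D, hU, hBU, hD, hDS, hUD⟩ := hfg
  refine ⟨U, D, hU, hBU, hD, fun p hp => ?_, hUD⟩
  refine Filter.EventuallyEq.deriv_eq ?_
  have hc : Continuous fun w : ℂ => (w, p.2) := by fun_prop
  have hmem : (fun w : ℂ => (w, p.2)) ⁻¹' D ∈ 𝓝 p.1 := (hD.preimage hc).mem_nhds hp
  filter_upwards [hmem] with w hw using hDS hw

/-- The partial derivative `∂/∂z`, as an operation on functions up to generic equality. -/
def dz (B : Set (ℂ × ℂ)) : FunGerm B → FunGerm B :=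
  Quotient.map' partialZ fun _ _ h => partialZ_congr B h

end ManinDenef

end

/-!
Put `v ^ 2 = z ^ 3 + δ z ^ 2 + z`. On each fibre of `δ`, the point `(x, v y)` lies on the curve
`Y ^ 2 = X ^ 3 + δ X ^ 2 + X`, and the invariant differential `dX / Y` pulls back to `ω dz / v`,
where `ω = x_z / y`; so `ω` should have no poles. The claim is local: it suffices that near each point
`p = (z₀, c)` the function `ω` agrees on a dense open set with an analytic germ, since such germs
glue (`exists_analyticOnNhd_of_local`).

Write `x = a / b`, `y = c / d` with analytic germs. Then `ω = W d / (b ^ 2 c)`, where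
`W = a_z b - a b_z`, and the equation of the curve compares `(b ^ 2 c) ^ 2` with `d ^ 2 F`, where
`F = a b (a ^ 2 + δ a b + b ^ 2)` is a quartic form. So poles of `ω` are controlled by comparing
`W ^ 2` with `F`, and this is done in two ways.

* On a slice `δ = w` with `w ^ 2 ≠ 4` the linear factors of `F` are distinct, at most one of them
  vanishes (after removal of a common factor of `a` and `b`), and differentiation lowers its order
  by one only: `ord F ≤ 2 ord W + 1`. By parity `ω` has no pole on the slice
  (`exists_eventually_eq_mul_of_slice`).
* Near a general point of the line `δ = c`, differentiation in `z` does not lower the order along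
  the line. Hence `|W| ^ 2 ≤ C |F|` there, even if `c ^ 2 = 4`
  (`exists_norm_wronskianZ_sq_le`).

A Hartogs-type argument combines the two (`exists_eventually_wronskianZ_mul_eq`). Split off the
power of `δ - c` from `b ^ 2 c`, leaving `H` with `H(z, c)` not identically zero, and choose a
circle around `z₀` on which `H(z, c) ≠ 0`. The Cauchy integral of `W d / H` over this circle is jointly
analytic (`analyticAt_cauchyIntegral`), and by the first comparison it equals `W d / H` on all
nearby slices `δ ≠ c`. By the second comparison it is divisible by the power of `δ - c`.
-/

noncomputable section

namespace ManinDenef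

/-! ### Parametric Cauchy integrals -/

/-- Osgood-type statement: a function of two variables that is analytic at each point of
`K × {c}`, `K` compact, gives an analytic map near `c` into the Banach algebra `C(K, ℂ)`. Joint
analyticity of parametric integrals reduces to this, as integrals are continuous linear
functionals on `C(K, ℂ)`. -/
theorem exists_analyticAt_continuousMap {K : Set ℂ} [CompactSpace K] {F : ℂ × ℂ → ℂ} {c : ℂ}
    (hF : ∀ ζ ∈ K, AnalyticAt ℂ F (ζ, c)) :
    ∃ Φ : ℂ → C(K, ℂ), AnalyticAt ℂ Φ c ∧ ∀ᶠ w in 𝓝 c, ∀ ζ : K, Φ w ζ = F (ζ, w) := by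
  classical
  have hK : IsCompact K := isCompact_iff_compactSpace.2 inferInstance
  have hV : ∀ᶠ w in 𝓝 c, ∀ ζ ∈ K, AnalyticAt ℂ F (ζ, w) := by
    refine hK.eventually_forall_of_forall_eventually fun ζ hζ => ?_
    have hs : Tendsto (fun q : ℂ × ℂ => (q.2, q.1)) (𝓝 (c, ζ)) (𝓝 (ζ, c)) :=
      (continuous_snd.prodMk continuous_fst).tendsto (c, ζ)
    exact hs.eventually (hF ζ hζ).eventually_analyticAt
  have hcont : ∀ w, (∀ ζ ∈ K, AnalyticAt ℂ F (ζ, w)) → Continuous fun ζ : K => F (ζ, w) :=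
    fun w hw => continuous_iff_continuousAt.2 fun ζ =>
      ContinuousAt.comp (f := fun ζ : K => ((ζ : ℂ), w)) (hw ζ ζ.2).continuousAt (by fun_prop)
  let Φ : ℂ → C(K, ℂ) := fun w =>
    if h : ∀ ζ ∈ K, AnalyticAt ℂ F (ζ, w) then ⟨_, hcont w h⟩ else 0
  have hΦ : ∀ w, (∀ ζ ∈ K, AnalyticAt ℂ F (ζ, w)) → ∀ ζ : K, Φ w ζ = F (ζ, w) := by
    intro w hw ζ
    simp only [Φ, dif_pos hw, ContinuousMap.coe_mk]
  refine ⟨Φ, ?_, hV.mono hΦ⟩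
  have hdiff : ∀ᶠ w in 𝓝 c, DifferentiableAt ℂ Φ w := by
    filter_upwards [hV.eventually_nhds] with w hw
    have hw0 := hw.self_of_nhds
    have hder : ∀ ζ ∈ K, ContinuousAt (fun q : ℂ × ℂ => fderiv ℂ F q (0, 1)) (ζ, w) :=
      fun ζ hζ => (hw0 ζ hζ).fderiv.continuousAt.clm_apply continuousAt_const
    let Ψ : C(K, ℂ) := ⟨fun ζ => fderiv ℂ F (ζ, w) (0, 1),
      continuous_iff_continuousAt.2 fun ζ =>
        ContinuousAt.comp (f := fun ζ : K => ((ζ : ℂ), w)) (hder ζ ζ.2) (by fun_prop)⟩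
    have key : HasDerivAt Φ Ψ w := by
      rw [hasDerivAt_iff_isLittleO, Asymptotics.isLittleO_iff]
      intro ε hε
      have hloc : ∀ᶠ v in 𝓝 w, ∀ ζ ∈ K,
          ‖F (ζ, v) - F (ζ, w) - (v - w) * fderiv ℂ F (ζ, w) (0, 1)‖ ≤ ε * ‖v - w‖ := by
        refine hK.eventually_forall_of_forall_eventually fun ζ hζ => ?_
        have h1 := ((hw0 ζ hζ).hasStrictFDerivAt.isLittleO).def (half_pos hε)
        have ht : Tendsto (fun q : ℂ × ℂ => ((q.2, q.1), (q.2, w))) (𝓝 (w, ζ))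
            (𝓝 ((ζ, w), (ζ, w))) := by
          have : Continuous fun q : ℂ × ℂ => ((q.2, q.1), (q.2, w)) := by fun_prop
          exact this.tendsto (w, ζ)
        have ht2 : Tendsto (fun q : ℂ × ℂ => (q.2, w)) (𝓝 (w, ζ)) (𝓝 (ζ, w)) := by
          have : Continuous fun q : ℂ × ℂ => (q.2, w) := by fun_prop
          exact this.tendsto (w, ζ)
        have h2 := ht2.eventually (Metric.continuousAt_iff'.1 (hder ζ hζ) _ (half_pos hε))
        filter_upwards [ht.eventually h1, h2] with q hq1 hq2
        have e1 : ((q.2, q.1) : ℂ × ℂ) - (q.2, w) = (q.1 - w) • ((0, 1) : ℂ × ℂ) := by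
          ext <;> simp
        have e2 : ‖(q.1 - w) • ((0, 1) : ℂ × ℂ)‖ = ‖q.1 - w‖ := by
          rw [norm_smul]; simp [Prod.norm_def]
        rw [e1, e2, map_smul, smul_eq_mul] at hq1
        rw [dist_eq_norm] at hq2
        calc ‖F (q.2, q.1) - F (q.2, w) - (q.1 - w) * fderiv ℂ F (q.2, w) (0, 1)‖
            = ‖(F (q.2, q.1) - F (q.2, w) - (q.1 - w) * fderiv ℂ F (ζ, w) (0, 1))
              - (q.1 - w) * (fderiv ℂ F (q.2, w) (0, 1) - fderiv ℂ F (ζ, w) (0, 1))‖ := by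
              congr 1; ring
          _ ≤ ε / 2 * ‖q.1 - w‖ + ‖q.1 - w‖ * (ε / 2) := by
              refine (norm_sub_le _ _).trans (add_le_add hq1 ?_)
              rw [norm_mul]
              exact mul_le_mul_of_nonneg_left hq2.le (norm_nonneg _)
          _ = ε * ‖q.1 - w‖ := by ring
      filter_upwards [hloc, hw] with v hv hvA
      rw [ContinuousMap.norm_le _ (by positivity)]
      intro ζ
      simpa [hΦ v hvA ζ, hΦ w hw0 ζ, Ψ] using hv ζ ζ.2
    exact key.differentiableAt
  exact DifferentiableOn.analyticAt (s := {w | DifferentiableAt ℂ Φ w})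
    (fun w hw => DifferentiableAt.differentiableWithinAt hw) hdiff

theorem exists_circleIntegral_clm (z₀ : ℂ) {r : ℝ} (hr : 0 ≤ r) :
    ∃ J : C(Metric.sphere z₀ r, ℂ) →L[ℂ] ℂ, ∀ (φ : C(Metric.sphere z₀ r, ℂ)) (f : ℂ → ℂ),
      (∀ ζ : Metric.sphere z₀ r, φ ζ = f ζ) → J φ = ∮ ζ in C(z₀, r), f ζ := by
  let γ : ℝ → Metric.sphere z₀ r := fun θ => ⟨circleMap z₀ r θ, circleMap_mem_sphere _ hr θ⟩
  have hγ : Continuous γ := (continuous_circleMap z₀ r).subtype_mk _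
  have hint : ∀ φ : C(Metric.sphere z₀ r, ℂ), IntervalIntegrable
      (fun θ => deriv (circleMap z₀ r) θ • φ (γ θ)) MeasureTheory.volume 0 (2 * Real.pi) := by
    intro φ
    refine Continuous.intervalIntegrable ?_ _ _
    have : Continuous (deriv (circleMap z₀ r)) := by
      simp only [funext (deriv_circleMap z₀ r)]
      exact (continuous_circleMap 0 r).mul continuous_const
    exact this.smul (φ.continuous.comp hγ)
  let L : C(Metric.sphere z₀ r, ℂ) →ₗ[ℂ] ℂ :=
    { toFun := fun φ => ∫ θ in (0 : ℝ)..2 * Real.pi, deriv (circleMap z₀ r) θ • φ (γ θ)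
      map_add' := fun φ ψ => by
        rw [← intervalIntegral.integral_add (hint φ) (hint ψ)]
        simp [mul_add]
      map_smul' := fun a φ => by
        rw [RingHom.id_apply, ← intervalIntegral.integral_smul]
        congr 1; ext θ; simp only [ContinuousMap.coe_smul, Pi.smul_apply, smul_eq_mul]; ring }
  refine ⟨L.mkContinuous (|r| * |2 * Real.pi - 0|) fun φ => ?_, fun φ f h => ?_⟩
  · have := intervalIntegral.norm_integral_le_of_norm_le_const (a := 0) (b := 2 * Real.pi)
      (C := |r| * ‖φ‖) (f := fun θ => deriv (circleMap z₀ r) θ • φ (γ θ)) (fun θ _ => by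
        rw [norm_smul]
        refine mul_le_mul (by simp) (φ.norm_coe_le_norm _) (norm_nonneg _) (abs_nonneg _))
    refine this.trans (le_of_eq (by ring))
  · simp [L, circleIntegral, γ, h]

/-- A Cauchy integral in the first variable is jointly analytic, as soon as the integrand is
analytic along the circle: nothing is assumed inside the disc. -/
theorem analyticAt_cauchyIntegral {F : ℂ × ℂ → ℂ} {z₀ c z : ℂ} {r : ℝ}
    (hF : ∀ ζ ∈ Metric.sphere z₀ r, AnalyticAt ℂ F (ζ, c)) (hz : z ∈ Metric.ball z₀ r) :
    AnalyticAt ℂ (fun q : ℂ × ℂ =>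
      (2 * Real.pi * Complex.I : ℂ)⁻¹ • ∮ ζ in C(z₀, r), (ζ - q.1)⁻¹ • F (ζ, q.2)) (z, c) := by
  have hr : 0 ≤ r := (dist_nonneg.trans_lt hz).le
  obtain ⟨J, hJ⟩ := exists_circleIntegral_clm z₀ hr
  obtain ⟨Φ, hΦ, hΦF⟩ := exists_analyticAt_continuousMap hF
  have hk : ∀ ζ ∈ Metric.sphere z₀ r, AnalyticAt ℂ (fun q : ℂ × ℂ => (q.1 - q.2)⁻¹) (ζ, z) := by
    intro ζ hζ
    refine (analyticAt_fst.sub analyticAt_snd).inv fun h => ?_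
    have : ζ = z := sub_eq_zero.1 h
    subst this
    exact (Metric.mem_ball.1 hz).ne (Metric.mem_sphere.1 hζ)
  obtain ⟨Κ, hΚ, hΚk⟩ := exists_analyticAt_continuousMap hk
  have hfst : AnalyticAt ℂ (fun q : ℂ × ℂ => Κ q.1) (z, c) := hΚ.fun_comp analyticAt_fst
  have hsnd : AnalyticAt ℂ (fun q : ℂ × ℂ => Φ q.2) (z, c) := hΦ.fun_comp analyticAt_snd
  have hA : AnalyticAt ℂ (fun q : ℂ × ℂ =>
      (2 * Real.pi * Complex.I : ℂ)⁻¹ • J (Κ q.1 * Φ q.2)) (z, c) :=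
    analyticAt_const.fun_smul ((J.analyticAt _).fun_comp (hfst.fun_mul hsnd))
  refine hA.congr ?_
  have e1 := (continuous_fst.tendsto (z, c)).eventually hΚk
  have e2 := (continuous_snd.tendsto (z, c)).eventually hΦF
  filter_upwards [e1, e2] with q h1 h2
  rw [hJ _ (fun ζ => (ζ - q.1)⁻¹ • F (ζ, q.2))]
  intro ζ
  simp [h1, h2]

/-- Cauchy's formula, for a function on the plane that is analytic at the points of a closed
disc. -/
theorem cauchyIntegral_eq {g : ℂ → ℂ} {z₀ z : ℂ} {r : ℝ}
    (hg : AnalyticOnNhd ℂ g (Metric.closedBall z₀ r)) (hz : z ∈ Metric.ball z₀ r) :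
    (2 * Real.pi * Complex.I : ℂ)⁻¹ • ∮ ζ in C(z₀, r), (ζ - z)⁻¹ • g ζ = g z := by
  rw [hg.differentiableOn.circleIntegral_sub_inv_smul hz, smul_smul, inv_mul_cancel₀, one_smul]
  exact Complex.two_pi_I_ne_zero

/-! ### Germs of analytic functions of two variables -/

theorem tendsto_slice (p : ℂ × ℂ) : Tendsto (fun z : ℂ => (z, p.2)) (𝓝 p.1) (𝓝 p) := by
  have : Continuous fun z : ℂ => (z, p.2) := by fun_prop
  exact this.tendsto p.1

theorem _root_.AnalyticAt.slice {f : ℂ × ℂ → ℂ} {z c : ℂ} (hf : AnalyticAt ℂ f (z, c)) :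
    AnalyticAt ℂ (fun w => f (w, c)) z :=
  AnalyticAt.fun_comp (f := fun w : ℂ => (w, c)) hf (analyticAt_id.prod analyticAt_const)

theorem _root_.AnalyticAt.slice_snd {f : ℂ × ℂ → ℂ} {z c : ℂ} (hf : AnalyticAt ℂ f (z, c)) :
    AnalyticAt ℂ (fun w => f (z, w)) c :=
  AnalyticAt.fun_comp (f := fun w : ℂ => (z, w)) hf (analyticAt_const.prod analyticAt_id)

theorem analyticAt_snd_sub (c : ℂ) (p : ℂ × ℂ) : AnalyticAt ℂ (fun q : ℂ × ℂ => q.2 - c) p :=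
  analyticAt_snd.sub analyticAt_const

/-- Division by a coordinate: an analytic germ that vanishes on the line `δ = p.2` is a multiple of
`δ - p.2`. -/
theorem exists_eq_snd_sub_mul {f : ℂ × ℂ → ℂ} {p : ℂ × ℂ} (hf : AnalyticAt ℂ f p)
    (h0 : ∀ᶠ z in 𝓝 p.1, f (z, p.2) = 0) :
    ∃ g : ℂ × ℂ → ℂ, AnalyticAt ℂ g p ∧ ∀ᶠ q in 𝓝 p, f q = (q.2 - p.2) * g q := by
  obtain ⟨R, hR, hfR⟩ := Metric.eventually_nhds_iff_ball.1 hf.eventually_analyticAt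
  set r := R / 2 with hr_def
  have hr : 0 < r := half_pos hR
  have hrR : r < R := half_lt_self hR
  have hmem : ∀ z ∈ Metric.ball p.1 R, ∀ w ∈ Metric.closedBall p.2 r,
      AnalyticAt ℂ f (z, w) := by
    intro z hz w hw
    refine hfR _ ?_
    rw [Metric.mem_ball, Prod.dist_eq]
    exact max_lt hz ((Metric.mem_closedBall.1 hw).trans_lt hrR)
  have hF : ∀ ζ ∈ Metric.sphere p.2 r,
      AnalyticAt ℂ (fun q : ℂ × ℂ => f (q.2, q.1) / (q.1 - p.2)) (ζ, p.1) := by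
    intro ζ hζ
    refine AnalyticAt.div (AnalyticAt.fun_comp (f := fun q : ℂ × ℂ => (q.2, q.1))
      (hmem _ (Metric.mem_ball_self hR) _ (Metric.sphere_subset_closedBall hζ))
      (analyticAt_snd.prod analyticAt_fst)) (analyticAt_fst.sub analyticAt_const) ?_
    exact sub_ne_zero.2 (Metric.ne_of_mem_sphere hζ hr.ne')
  have hG := analyticAt_cauchyIntegral hF (Metric.mem_ball_self hr)
  refine ⟨_, AnalyticAt.fun_comp (f := fun q : ℂ × ℂ => (q.2, q.1)) (x := p) hG
    (analyticAt_snd.prod analyticAt_fst), ?_⟩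
  have h1 : ∀ᶠ q in 𝓝 p, q.2 ∈ Metric.ball p.2 r :=
    (continuous_snd.tendsto p).eventually (Metric.ball_mem_nhds _ hr)
  have h2 : ∀ᶠ q in 𝓝 p, q.1 ∈ Metric.ball p.1 R :=
    (continuous_fst.tendsto p).eventually (Metric.ball_mem_nhds _ hR)
  filter_upwards [h1, h2, (continuous_fst.tendsto p).eventually h0] with q hq1 hq2 hq3
  have hs : AnalyticOnNhd ℂ (fun w => f (q.1, w)) (Metric.closedBall p.2 r) :=
    fun w hw => (hmem _ hq2 w hw).slice_snd
  have hd : DifferentiableOn ℂ (dslope (fun w => f (q.1, w)) p.2) (Metric.closedBall p.2 r) :=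
    (Complex.differentiableOn_dslope (Metric.closedBall_mem_nhds _ hr)).2 hs.differentiableOn
  have hc : (2 * Real.pi * Complex.I : ℂ)⁻¹ • ∮ ζ in C(p.2, r),
      (ζ - q.2)⁻¹ • (f (q.1, ζ) / (ζ - p.2)) = dslope (fun w => f (q.1, w)) p.2 q.2 := by
    rw [← (inv_smul_eq_iff₀ Complex.two_pi_I_ne_zero).2 (hd.circleIntegral_sub_inv_smul hq1)]
    congr 1
    refine circleIntegral.integral_congr hr.le fun ζ hζ => ?_
    have hne : ζ ≠ p.2 := Metric.ne_of_mem_sphere hζ hr.ne'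
    simp only [dslope_of_ne _ hne, slope_def_field, hq3, sub_zero]
  have := sub_smul_dslope (fun w => f (q.1, w)) p.2 q.2
  simp only [smul_eq_mul, hq3, sub_zero] at this
  rw [← this, ← hc]

/-- If an analytic germ is not zero, its nonvanishing set is dense near the base point. -/
theorem _root_.AnalyticAt.eventually_frequently_ne {E : Type*} [NormedAddCommGroup E]
    [NormedSpace ℂ E] {f : E → ℂ} {p : E} (hf : AnalyticAt ℂ f p) (h : ∃ᶠ q in 𝓝 p, f q ≠ 0) :
    ∀ᶠ q in 𝓝 p, ∃ᶠ q' in 𝓝 q, f q' ≠ 0 := by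
  obtain ⟨R, hR, hfR⟩ := Metric.eventually_nhds_iff_ball.1 hf.eventually_analyticAt
  filter_upwards [Metric.ball_mem_nhds p hR] with q hq
  intro hcon
  have hpc : IsPreconnected (Metric.ball p R) :=
    letI := NormedSpace.restrictScalars ℝ ℂ E
    (convex_ball p R).isPreconnected
  have hz := AnalyticOnNhd.eqOn_zero_of_preconnected_of_eventuallyEq_zero (f := f) hfR hpc hq
    (by filter_upwards [hcon] with x hx using not_not.1 hx)
  obtain ⟨x, hx, hxR⟩ := (h.and_eventually (Metric.ball_mem_nhds p hR)).exists
  exact hx (hz hxR)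

theorem _root_.AnalyticAt.frequently_mul_ne {E : Type*} [NormedAddCommGroup E]
    [NormedSpace ℂ E] {f g : E → ℂ} {p : E} (hf : AnalyticAt ℂ f p) (hg : AnalyticAt ℂ g p)
    (hf0 : ∃ᶠ q in 𝓝 p, f q ≠ 0) (hg0 : ∃ᶠ q in 𝓝 p, g q ≠ 0) :
    ∃ᶠ q in 𝓝 p, f q * g q ≠ 0 := by
  rw [← frequently_frequently_nhds]
  refine ((hg0.and_eventually (hf.eventually_frequently_ne hf0)).and_eventually
    hg.eventually_analyticAt).mono ?_
  rintro q ⟨⟨hgq, hfq⟩, hgc⟩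
  exact (hfq.and_eventually (hgc.continuousAt.eventually_ne hgq)).mono
    fun q' h => mul_ne_zero h.1 h.2

theorem frequently_snd_ne (p : ℂ × ℂ) : ∃ᶠ q : ℂ × ℂ in 𝓝 p, q.2 - p.2 ≠ 0 := by
  have h : ∃ᶠ w in 𝓝[≠] p.2, w - p.2 ≠ 0 :=
    Eventually.frequently (by
      filter_upwards [self_mem_nhdsWithin] with w hw using sub_ne_zero.2 hw)
  have ht : Tendsto (fun w : ℂ => (p.1, w)) (𝓝[≠] p.2) (𝓝 p) := by
    have : Continuous fun w : ℂ => (p.1, w) := by fun_prop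
    exact (this.tendsto p.2).mono_left nhdsWithin_le_nhds
  exact ht.frequently h

/-- An analytic germ that vanishes off the line `δ = p.2` is zero. -/
theorem eventually_eq_zero_of_off_line {f : ℂ × ℂ → ℂ} {p : ℂ × ℂ} (hf : AnalyticAt ℂ f p)
    (h : ∀ᶠ q in 𝓝 p, q.2 - p.2 ≠ 0 → f q = 0) : ∀ᶠ q in 𝓝 p, f q = 0 := by
  by_contra hcon
  have := (hf.frequently_mul_ne (analyticAt_snd_sub p.2 p) (not_eventually.1 hcon)
    (frequently_snd_ne p)).and_eventually h
  obtain ⟨q, hq, hq'⟩ := this.exists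
  exact hq (by rw [hq' (right_ne_zero_of_mul hq), zero_mul])

/-- The order of vanishing along the line `δ = p.2` can be split off a nonzero germ. -/
theorem exists_eq_pow_mul {f : ℂ × ℂ → ℂ} {p : ℂ × ℂ} (hf : AnalyticAt ℂ f p)
    (h0 : ∃ᶠ q in 𝓝 p, f q ≠ 0) :
    ∃ (n : ℕ) (g : ℂ × ℂ → ℂ), AnalyticAt ℂ g p ∧ (∀ᶠ z in 𝓝[≠] p.1, g (z, p.2) ≠ 0) ∧
      ∀ᶠ q in 𝓝 p, f q = (q.2 - p.2) ^ n * g q := by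
  by_contra hcon
  push Not at hcon
  have hall : ∀ n : ℕ, ∃ g : ℂ × ℂ → ℂ, AnalyticAt ℂ g p ∧
      ∀ᶠ q in 𝓝 p, f q = (q.2 - p.2) ^ n * g q := by
    intro n
    induction n with
    | zero => exact ⟨f, hf, Eventually.of_forall fun q => by simp⟩
    | succ n ih =>
      obtain ⟨g, hg, hfg⟩ := ih
      have hsl : AnalyticAt ℂ (fun z => g (z, p.2)) p.1 := AnalyticAt.slice hg
      rcases hsl.eventually_eq_zero_or_eventually_ne_zero with h | h
      · obtain ⟨g', hg', hgg'⟩ := exists_eq_snd_sub_mul hg h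
        refine ⟨g', hg', ?_⟩
        filter_upwards [hfg, hgg'] with q h1 h2
        rw [h1, h2]; ring
      · exact absurd hfg (not_eventually.2 (hcon n g hg h))
  -- Restricted to a complex line through `p` on which it does not vanish, `f` has finite order,
  -- and this order bounds the exponent `n`.
  obtain ⟨R, hR, hfR⟩ := Metric.eventually_nhds_iff_ball.1 hf.eventually_analyticAt
  obtain ⟨q, hq, hqR⟩ := (h0.and_eventually (Metric.ball_mem_nhds p hR)).exists
  set ℓ : ℂ → ℂ × ℂ := fun s => p + s • (q - p) with hℓ
  have hℓa : ∀ s, AnalyticAt ℂ ℓ s := fun s =>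
    analyticAt_const.add (analyticAt_id.smul analyticAt_const)
  have hℓ0 : ℓ 0 = p := by simp [hℓ]
  have hmem : ∀ s ∈ Metric.closedBall (0 : ℂ) 1, ℓ s ∈ Metric.ball p R := by
    intro s hs
    have hs' : ‖s‖ ≤ 1 := by simpa using hs
    rw [dist_eq_norm] at hqR
    rw [Metric.mem_ball, dist_eq_norm]
    rw [hℓ]
    simp only [add_sub_cancel_left, norm_smul]
    exact (mul_le_of_le_one_left (norm_nonneg _) hs').trans_lt hqR
  have hline : AnalyticOnNhd ℂ (fun s => f (ℓ s)) (Metric.closedBall 0 1) :=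
    fun s hs => (hfR _ (hmem s hs)).fun_comp (hℓa s)
  have hfin : analyticOrderAt (fun s => f (ℓ s)) 0 ≠ ⊤ := by
    intro htop
    rw [analyticOrderAt_eq_top] at htop
    have := hline.eqOn_zero_of_preconnected_of_eventuallyEq_zero
      (convex_closedBall (0 : ℂ) 1).isPreconnected (by simp) htop
    have h1 := this (show (1 : ℂ) ∈ Metric.closedBall 0 1 by simp)
    exact hq (by simpa [hℓ] using h1)
  obtain ⟨g, hg, hfg⟩ := hall (analyticOrderNatAt (fun s => f (ℓ s)) 0 + 1)
  have ht : Tendsto ℓ (𝓝 0) (𝓝 p) := by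
    have := (hℓa 0).continuousAt.tendsto
    rwa [hℓ0] at this
  have hle : ((analyticOrderNatAt (fun s => f (ℓ s)) 0 + 1 : ℕ) : ℕ∞)
      ≤ analyticOrderAt (fun s => f (ℓ s)) 0 := by
    rw [natCast_le_analyticOrderAt (hline 0 (by simp))]
    refine ⟨fun s => (q.2 - p.2) ^ (analyticOrderNatAt (fun s => f (ℓ s)) 0 + 1) * g (ℓ s),
      analyticAt_const.mul ((hℓ0 ▸ hg : AnalyticAt ℂ g (ℓ 0)).fun_comp (hℓa 0)), ?_⟩
    filter_upwards [ht.eventually hfg] with s hs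
    rw [hs]
    simp only [hℓ, Prod.snd_add, Prod.smul_snd, Prod.snd_sub, add_sub_cancel_left, smul_eq_mul,
      sub_zero, mul_pow]
    ring
  rw [← Nat.cast_analyticOrderNatAt hfin, Nat.cast_le] at hle
  omega

/-! ### Gluing analytic functions that agree generically -/

theorem eq_of_frequently_eq_of_continuousAt {E : Type*} [TopologicalSpace E] {f g : E → ℂ} {p : E}
    (hf : ContinuousAt f p) (hg : ContinuousAt g p) (h : ∃ᶠ q in 𝓝 p, f q = g q) : f p = g p := by
  by_contra hne
  obtain ⟨q, hq, hq'⟩ :=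
    (h.and_eventually ((hf.sub hg).eventually_ne (sub_ne_zero.2 hne))).exists
  exact hq' (sub_eq_zero.2 hq)

/-- Local analytic functions that agree with a given function `f` on a dense open set glue to one
analytic function. Agreement on a dense open set is expressed by the points near which `f` and the
analytic function coincide. -/
theorem exists_analyticOnNhd_of_local {E : Type*} [NormedAddCommGroup E] [NormedSpace ℂ E]
    {U : Set E} (hU : IsOpen U) {f : E → ℂ}
    (h : ∀ p ∈ U, ∃ g : E → ℂ, AnalyticAt ℂ g p ∧
      ∀ᶠ q in 𝓝 p, ∃ᶠ q' in 𝓝 q, f =ᶠ[𝓝 q'] g) :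
    ∃ G : E → ℂ, AnalyticOnNhd ℂ G U ∧ ∀ q ∈ U, ∃ᶠ q' in 𝓝 q, f =ᶠ[𝓝 q'] G := by
  classical
  choose! g hg hfg using h
  have hG : ∀ p ∈ U, (fun q => g q q) =ᶠ[𝓝 p] g p := by
    intro p hp
    filter_upwards [hU.mem_nhds hp, (hg p hp).eventually_analyticAt, hfg p hp] with q hq h1 h2
    refine eq_of_frequently_eq_of_continuousAt (hg q hq).continuousAt h1.continuousAt ?_
    rw [← frequently_frequently_nhds]
    refine (h2.and_eventually (hfg q hq)).mono ?_
    rintro q' ⟨h3, h4⟩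
    refine (h4.and_eventually h3).mono ?_
    rintro x ⟨h5, h6⟩
    exact h5.self_of_nhds.symm.trans h6
  refine ⟨fun q => g q q, fun p hp => (hg p hp).congr (hG p hp).symm, fun p hp => ?_⟩
  refine ((hfg p hp).self_of_nhds.and_eventually (hG p hp).eventually_nhds).mono ?_
  rintro q ⟨h1, h2⟩
  exact h1.trans (EventuallyEq.symm h2)

/-! ### Orders of vanishing in one variable -/

theorem exists_eventuallyEq_mul_of_analyticOrderAt_le {f g : ℂ → ℂ} {z : ℂ}
    (hf : AnalyticAt ℂ f z) (hg : AnalyticAt ℂ g z) (hg0 : analyticOrderAt g z ≠ ⊤)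
    (h : analyticOrderAt g z ≤ analyticOrderAt f z) :
    ∃ k : ℂ → ℂ, AnalyticAt ℂ k z ∧ ∀ᶠ w in 𝓝 z, f w = g w * k w := by
  obtain ⟨g₁, hg₁, hg₁0, hgg⟩ := hg.analyticOrderAt_ne_top.1 hg0
  rw [← Nat.cast_analyticOrderNatAt hg0, natCast_le_analyticOrderAt hf] at h
  obtain ⟨f₁, hf₁, hff⟩ := h
  refine ⟨fun w => f₁ w / g₁ w, hf₁.div hg₁ hg₁0, ?_⟩
  filter_upwards [hgg, hff, hg₁.continuousAt.eventually_ne hg₁0] with w h1 h2 h3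
  rw [h1, h2, smul_eq_mul, smul_eq_mul]
  field_simp

theorem analyticOrderAt_le_deriv_add_one {f : ℂ → ℂ} {z : ℂ} (hf : AnalyticAt ℂ f z)
    (h0 : f z = 0) : analyticOrderAt f z ≤ analyticOrderAt (deriv f) z + 1 := by
  rw [hf.analyticOrderAt_deriv_add_one]
  simp [h0]

theorem analyticOrderAt_eq_zero_of_ne {f : ℂ → ℂ} {z : ℂ} (h : f z ≠ 0) :
    analyticOrderAt f z = 0 :=
  analyticOrderAt_eq_zero.2 (Or.inr h)

theorem le_analyticOrderAt_mul_left {f g : ℂ → ℂ} {z : ℂ} (hf : AnalyticAt ℂ f z)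
    (hg : AnalyticAt ℂ g z) : analyticOrderAt f z ≤ analyticOrderAt (f * g) z := by
  rw [analyticOrderAt_mul hf hg]
  exact le_self_add

theorem le_analyticOrderAt_mul_right {f g : ℂ → ℂ} {z : ℂ} (hf : AnalyticAt ℂ f z)
    (hg : AnalyticAt ℂ g z) : analyticOrderAt g z ≤ analyticOrderAt (f * g) z := by
  rw [analyticOrderAt_mul hf hg]
  exact le_add_self

theorem analyticOrderAt_pow_sub_mul {f : ℂ → ℂ} {z : ℂ} (hf : AnalyticAt ℂ f z) (n : ℕ) :
    analyticOrderAt (fun w => (w - z) ^ n * f w) z = n + analyticOrderAt f z := by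
  have h1 : AnalyticAt ℂ (fun w : ℂ => (w - z) ^ n) z := by fun_prop
  have := analyticOrderAt_mul h1 hf
  rw [← analyticOrderAt_centeredMonomial (z₀ := z) (n := n)]
  exact this

/-- The Wronskian of two functions of one variable, with the sign of `(a / b)' * b ^ 2`. -/
def wronskian (a b : ℂ → ℂ) (w : ℂ) : ℂ := deriv a w * b w - a w * deriv b w

/-- The homogeneous form `a ^ 2 + δ a b + b ^ 2` attached to the quadratic factor of
`x ^ 3 + δ x ^ 2 + x` at `x = a / b`. -/
def conic (δ a b : ℂ) : ℂ := a ^ 2 + δ * a * b + b ^ 2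

theorem conic_swap (δ a b : ℂ) : conic δ b a = conic δ a b := by
  unfold conic; ring

theorem analyticAt_wronskian {a b : ℂ → ℂ} {z : ℂ} (ha : AnalyticAt ℂ a z)
    (hb : AnalyticAt ℂ b z) : AnalyticAt ℂ (wronskian a b) z :=
  (ha.deriv.mul hb).sub (ha.mul hb.deriv)

theorem analyticAt_conic {E : Type*} [NormedAddCommGroup E] [NormedSpace ℂ E] {d a b : E → ℂ}
    {z : E} (hd : AnalyticAt ℂ d z) (ha : AnalyticAt ℂ a z) (hb : AnalyticAt ℂ b z) :
    AnalyticAt ℂ (fun w => conic (d w) (a w) (b w)) z :=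
  ((ha.fun_pow 2).fun_add ((hd.fun_mul ha).fun_mul hb)).fun_add (hb.fun_pow 2)

theorem two_mul_add_ne_zero {δ a b : ℂ} (hδ : δ ^ 2 ≠ 4) (hb : b ≠ 0) (hq : conic δ a b = 0) :
    2 * a + δ * b ≠ 0 := by
  intro h
  have : (δ ^ 2 - 4) * b ^ 2 = (2 * a + δ * b) ^ 2 - 4 * conic δ a b := by unfold conic; ring
  rw [h, hq] at this
  have h2 : (δ ^ 2 - 4) * b ^ 2 = 0 := by rw [this]; ring
  rcases mul_eq_zero.1 h2 with h3 | h3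
  · exact hδ (sub_eq_zero.1 h3)
  · exact hb (pow_eq_zero_iff (two_ne_zero) |>.1 h3)

theorem wronskian_swap (a b : ℂ → ℂ) : wronskian b a = -wronskian a b := by
  ext w; simp [wronskian]; ring

theorem analyticOrderAt_quartic_le_of_ne {a b : ℂ → ℂ} {z δ : ℂ} (hδ : δ ^ 2 ≠ 4)
    (ha : AnalyticAt ℂ a z) (hb : AnalyticAt ℂ b z) (hbz : b z ≠ 0) :
    analyticOrderAt (fun w => a w * b w * conic δ (a w) (b w)) z
      ≤ 2 * analyticOrderAt (wronskian a b) z + 1 := by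
  set Q : ℂ → ℂ := fun w => conic δ (a w) (b w) with hQ
  have hQa : AnalyticAt ℂ Q z := analyticAt_conic analyticAt_const ha hb
  have hW := analyticAt_wronskian ha hb
  have hF : analyticOrderAt (fun w => a w * b w * conic δ (a w) (b w)) z
      = analyticOrderAt a z + analyticOrderAt Q z := by
    have : (fun w => a w * b w * conic δ (a w) (b w)) = a * b * Q := rfl
    rw [this, analyticOrderAt_mul (ha.mul hb) hQa, analyticOrderAt_mul ha hb,
      analyticOrderAt_eq_zero_of_ne hbz, add_zero]
  have hle : analyticOrderAt (wronskian a b) z + 1 ≤ 2 * analyticOrderAt (wronskian a b) z + 1 := by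
    gcongr
    rw [two_mul]
    exact le_self_add
  rw [hF]
  by_cases haz : a z = 0
  · have hQz : Q z ≠ 0 := by simp [hQ, conic, haz, hbz]
    rw [analyticOrderAt_eq_zero_of_ne hQz, add_zero]
    refine le_trans ?_ hle
    obtain ⟨n, hn⟩ | htop : (∃ n : ℕ, analyticOrderAt a z = n + 1) ∨ analyticOrderAt a z = ⊤ := by
      by_cases htop : analyticOrderAt a z = ⊤
      · exact Or.inr htop
      · refine Or.inl ⟨analyticOrderNatAt a z - 1, ?_⟩
        have h0 : analyticOrderAt a z ≠ 0 := analyticOrderAt_ne_zero.2 ⟨ha, haz⟩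
        have h1 := Nat.cast_analyticOrderNatAt htop
        rw [← h1] at h0 ⊢
        have : analyticOrderNatAt a z ≠ 0 := by exact_mod_cast h0
        norm_cast
        omega
    · have hd : (n : ℕ∞) ≤ analyticOrderAt (deriv a) z := by
        have := analyticOrderAt_le_deriv_add_one ha haz
        rw [hn] at this
        exact (ENat.add_le_add_iff_right (by simp)).1 this
      rw [hn]
      gcongr
      have hsub : wronskian a b = deriv a * b - a * deriv b := rfl
      rw [hsub]
      refine le_trans (le_min ?_ ?_) le_analyticOrderAt_sub
      · exact hd.trans (le_analyticOrderAt_mul_left ha.deriv hb)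
      · refine le_trans ?_ (le_analyticOrderAt_mul_left ha hb.deriv)
        rw [hn]; exact le_self_add
    · have hz : ∀ᶠ w in 𝓝 z, a w = 0 := analyticOrderAt_eq_top.1 htop
      have : analyticOrderAt (wronskian a b) z = ⊤ := by
        rw [analyticOrderAt_eq_top]
        filter_upwards [hz.eventually_nhds] with w hw
        have : deriv a w = 0 := by
          rw [EventuallyEq.deriv_eq (show a =ᶠ[𝓝 w] fun _ => 0 from hw)]; simp
        simp [wronskian, this, hw.self_of_nhds]
      simp [this]
  · rw [analyticOrderAt_eq_zero_of_ne haz, zero_add]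
    by_cases hQz : Q z = 0
    · refine le_trans ?_ hle
      have hunit : analyticOrderAt (fun w => 2 * a w + δ * b w) z = 0 :=
        analyticOrderAt_eq_zero_of_ne (two_mul_add_ne_zero hδ hbz hQz)
      have hid : (fun w => 2 * a w + δ * b w) * wronskian a b
          =ᶠ[𝓝 z] b * deriv Q - (fun _ => 2) * deriv b * Q := by
        filter_upwards [ha.eventually_analyticAt, hb.eventually_analyticAt] with w haw hbw
        have h1 := haw.differentiableAt.hasDerivAt
        have h2 := hbw.differentiableAt.hasDerivAt
        have h3 : HasDerivAt Q (2 * a w * deriv a w + (δ * deriv a w * b w + δ * a w * deriv b w)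
            + 2 * b w * deriv b w) w := by
          have := ((h1.pow 2).add ((h1.const_mul δ).mul h2)).add (h2.pow 2)
          refine this.congr_deriv ?_
          simp
        simp only [Pi.mul_apply, Pi.sub_apply, h3.deriv, wronskian]
        simp only [hQ, conic]
        ring
      have hlin : AnalyticAt ℂ (fun w => 2 * a w + δ * b w) z := by fun_prop
      have hWo : analyticOrderAt (wronskian a b) z
          = analyticOrderAt (b * deriv Q - (fun _ => 2) * deriv b * Q) z := by
        rw [← analyticOrderAt_congr hid, analyticOrderAt_mul hlin hW, hunit, zero_add]
      have hmin : min (analyticOrderAt (deriv Q) z) (analyticOrderAt Q z)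
          ≤ analyticOrderAt (wronskian a b) z := by
        rw [hWo]
        refine le_trans (min_le_min ?_ ?_) le_analyticOrderAt_sub
        · exact le_analyticOrderAt_mul_right hb hQa.deriv
        · exact le_analyticOrderAt_mul_right (analyticAt_const.mul hb.deriv) hQa
      refine le_trans ?_ (add_le_add_left hmin 1)
      rcases min_choice (analyticOrderAt (deriv Q) z) (analyticOrderAt Q z) with h | h <;> rw [h]
      · exact analyticOrderAt_le_deriv_add_one hQa hQz
      · exact le_self_add
    · rw [analyticOrderAt_eq_zero_of_ne hQz]
      exact zero_le

/-- The quartic form `a b (a ^ 2 + δ a b + b ^ 2)` has simple linear factors if `δ ^ 2 ≠ 4`; hence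
the Wronskian of `a` and `b` loses at most one order of vanishing against any of them. -/
theorem analyticOrderAt_quartic_le {a b : ℂ → ℂ} {z δ : ℂ} (hδ : δ ^ 2 ≠ 4)
    (ha : AnalyticAt ℂ a z) (hb : AnalyticAt ℂ b z) (hb0 : analyticOrderAt b z ≠ ⊤) :
    analyticOrderAt (fun w => a w * b w * conic δ (a w) (b w)) z
      ≤ 2 * analyticOrderAt (wronskian a b) z + 1 := by
  obtain ⟨k, hk⟩ : ∃ k : ℕ, (k : ℕ∞) = min (analyticOrderAt a z) (analyticOrderAt b z) := by
    refine ENat.ne_top_iff_exists.1 fun h => hb0 ?_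
    exact (min_eq_top.1 h).2
  obtain ⟨a₁, ha₁, haa⟩ := (natCast_le_analyticOrderAt ha).1 (hk.le.trans (min_le_left _ _))
  obtain ⟨b₁, hb₁, hbb⟩ := (natCast_le_analyticOrderAt hb).1 (hk.le.trans (min_le_right _ _))
  simp only [smul_eq_mul] at haa hbb
  have hao : analyticOrderAt a z = k + analyticOrderAt a₁ z := by
    rw [analyticOrderAt_congr haa, analyticOrderAt_pow_sub_mul ha₁]
  have hbo : analyticOrderAt b z = k + analyticOrderAt b₁ z := by
    rw [analyticOrderAt_congr hbb, analyticOrderAt_pow_sub_mul hb₁]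
  have hne : a₁ z ≠ 0 ∨ b₁ z ≠ 0 := by
    by_contra hcon
    push Not at hcon
    have h1 : (1 : ℕ∞) ≤ analyticOrderAt a₁ z :=
      Order.one_le_iff_ne_zero.2 (analyticOrderAt_ne_zero.2 ⟨ha₁, hcon.1⟩)
    have h2 : (1 : ℕ∞) ≤ analyticOrderAt b₁ z :=
      Order.one_le_iff_ne_zero.2 (analyticOrderAt_ne_zero.2 ⟨hb₁, hcon.2⟩)
    have h3 : (k : ℕ∞) + 1 ≤ k := by
      conv_rhs => rw [hk, hao, hbo]
      exact le_min (by gcongr) (by gcongr)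
    exact absurd h3 (by norm_cast; omega)
  have hF : analyticOrderAt (fun w => a w * b w * conic δ (a w) (b w)) z
      = (4 * k : ℕ) + analyticOrderAt (fun w => a₁ w * b₁ w * conic δ (a₁ w) (b₁ w)) z := by
    rw [← analyticOrderAt_pow_sub_mul ((ha₁.fun_mul hb₁).fun_mul
      (analyticAt_conic analyticAt_const ha₁ hb₁))]
    refine analyticOrderAt_congr ?_
    filter_upwards [haa, hbb] with w h1 h2
    simp only [h1, h2, conic]
    ring
  have hW : analyticOrderAt (wronskian a b) z
      = (2 * k : ℕ) + analyticOrderAt (wronskian a₁ b₁) z := by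
    rw [← analyticOrderAt_pow_sub_mul (analyticAt_wronskian ha₁ hb₁)]
    refine analyticOrderAt_congr ?_
    filter_upwards [EventuallyEq.eventuallyEq_nhds haa, EventuallyEq.eventuallyEq_nhds hbb,
      ha₁.eventually_analyticAt, hb₁.eventually_analyticAt] with w h1 h2 h3 h4
    have ht : HasDerivAt (fun w : ℂ => (w - z) ^ k) (deriv (fun w : ℂ => (w - z) ^ k) w) w :=
      DifferentiableAt.hasDerivAt (by fun_prop)
    have e1 := (ht.fun_mul h3.differentiableAt.hasDerivAt).deriv
    have e2 := (ht.fun_mul h4.differentiableAt.hasDerivAt).deriv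
    simp only [wronskian, h1.deriv_eq, h2.deriv_eq, e1, e2, h1.self_of_nhds, h2.self_of_nhds]
    ring
  have hmain : analyticOrderAt (fun w => a₁ w * b₁ w * conic δ (a₁ w) (b₁ w)) z
      ≤ 2 * analyticOrderAt (wronskian a₁ b₁) z + 1 := by
    rcases hne with h | h
    · have := analyticOrderAt_quartic_le_of_ne hδ hb₁ ha₁ h
      rw [wronskian_swap, analyticOrderAt_neg] at this
      convert this using 3 with w
      rw [conic_swap]; ring
    · exact analyticOrderAt_quartic_le_of_ne hδ ha₁ hb₁ h
  rw [hF, hW]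
  calc ((4 * k : ℕ) : ℕ∞) + _
      ≤ ((4 * k : ℕ) : ℕ∞) + (2 * analyticOrderAt (wronskian a₁ b₁) z + 1) := by gcongr
    _ = _ := by push_cast; ring

theorem two_mul_add_le_of_le {m n : ℕ∞} (h : 2 * m ≤ 2 * n + 1) : m ≤ n := by
  induction n using ENat.recTopCoe with
  | top => exact le_top
  | coe n =>
    induction m using ENat.recTopCoe with
    | top =>
      exfalso
      have : (2 * (⊤ : ℕ∞)) = ⊤ := by simp
      rw [this, top_le_iff] at h
      exact absurd h (ENat.natCast_ne_top (2 * n + 1))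
    | coe m => norm_cast at h ⊢; omega

/-- On a smooth fibre `δ ^ 2 ≠ 4` the differential `x_z / y` has no poles, where `x = a / b` and
`y = c / d`. By parity of orders, an inequality up to one unit suffices. -/
theorem exists_eventually_eq_mul_of_slice {P a b c d : ℂ → ℂ} {z δ : ℂ} (hδ : δ ^ 2 ≠ 4)
    (hP : AnalyticAt ℂ P z) (ha : AnalyticAt ℂ a z) (hb : AnalyticAt ℂ b z)
    (hc : AnalyticAt ℂ c z) (hd : AnalyticAt ℂ d z)
    (h0 : ∃ᶠ w in 𝓝 z, b w ^ 2 * c w ≠ 0)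
    (h : ∀ᶠ w in 𝓝 z, P w * c w ^ 2 * b w ^ 3 = d w ^ 2 * (a w * conic δ (a w) (b w))) :
    ∃ g : ℂ → ℂ, AnalyticAt ℂ g z ∧
      ∀ᶠ w in 𝓝 z, wronskian a b w * d w = b w ^ 2 * c w * g w := by
  have hW := analyticAt_wronskian ha hb
  have hHa : AnalyticAt ℂ (b ^ 2 * c) z := (hb.pow 2).mul hc
  have hH0 : analyticOrderAt (b ^ 2 * c) z ≠ ⊤ := by
    rw [ne_eq, analyticOrderAt_eq_top, not_eventually]
    exact h0
  refine exists_eventuallyEq_mul_of_analyticOrderAt_le (hW.mul hd) hHa hH0 ?_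
  have hb0 : analyticOrderAt b z ≠ ⊤ := by
    intro htop
    rw [analyticOrderAt_eq_top] at htop
    obtain ⟨w, hw, hw'⟩ := (h0.and_eventually htop).exists
    exact hw (by simp [hw'])
  refine two_mul_add_le_of_le ?_
  have hFa : AnalyticAt ℂ (fun w => a w * b w * conic δ (a w) (b w)) z :=
    (ha.fun_mul hb).fun_mul (analyticAt_conic analyticAt_const ha hb)
  have heq : P * (b ^ 2 * c) ^ 2 =ᶠ[𝓝 z] d ^ 2 * fun w => a w * b w * conic δ (a w) (b w) := by
    filter_upwards [h] with w hw
    simp only [Pi.mul_apply, Pi.pow_apply]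
    linear_combination b w * hw
  have ho := analyticOrderAt_congr heq
  rw [analyticOrderAt_mul hP (hHa.pow 2), analyticOrderAt_mul (hd.pow 2) hFa,
    analyticOrderAt_pow hHa, analyticOrderAt_pow hd] at ho
  have hWd : analyticOrderAt (fun w => wronskian a b w * d w) z
      = analyticOrderAt (wronskian a b) z + analyticOrderAt d z := analyticOrderAt_mul hW hd
  rw [hWd]
  change 2 * analyticOrderAt (b ^ 2 * c) z ≤ _
  have hmain := analyticOrderAt_quartic_le hδ ha hb hb0
  calc 2 * analyticOrderAt (b ^ 2 * c) z
      ≤ analyticOrderAt P z + 2 • analyticOrderAt (b ^ 2 * c) z := by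
        rw [nsmul_eq_mul]; exact le_add_self
    _ = 2 • analyticOrderAt d z
          + analyticOrderAt (fun w => a w * b w * conic δ (a w) (b w)) z := ho
    _ ≤ 2 • analyticOrderAt d z + (2 * analyticOrderAt (wronskian a b) z + 1) := by gcongr
    _ = 2 * (analyticOrderAt (wronskian a b) z + analyticOrderAt d z) + 1 := by
        rw [nsmul_eq_mul]; push_cast; ring

/-- Local quotients `N / H` of analytic functions glue to a global one. -/
theorem exists_analyticOnNhd_quotient {N H : ℂ → ℂ} {U : Set ℂ} (hU : IsOpen U)
    (hUc : IsPreconnected U) (hN : AnalyticOnNhd ℂ N U) (hH : AnalyticOnNhd ℂ H U) {z₁ : ℂ}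
    (hz₁ : z₁ ∈ U) (hHz₁ : H z₁ ≠ 0)
    (h : ∀ z ∈ U, ∃ g : ℂ → ℂ, AnalyticAt ℂ g z ∧ ∀ᶠ w in 𝓝 z, N w = H w * g w) :
    ∃ G : ℂ → ℂ, AnalyticOnNhd ℂ G U ∧ ∀ z ∈ U, N z = H z * G z := by
  have hH0 : ∀ z ∈ U, ∃ᶠ w in 𝓝 z, H w ≠ 0 := fun z hz hcon =>
    hHz₁ (hH.eqOn_zero_of_preconnected_of_eventuallyEq_zero hUc hz
      (by filter_upwards [hcon] with w hw using not_not.1 hw) hz₁)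
  obtain ⟨G, hG, hGf⟩ := exists_analyticOnNhd_of_local (f := fun w => N w / H w) hU (by
    intro z hz
    obtain ⟨g, hg, hgN⟩ := h z hz
    refine ⟨g, hg, ?_⟩
    filter_upwards [(hH z hz).eventually_frequently_ne (hH0 z hz), hgN.eventually_nhds,
      (hH z hz).eventually_analyticAt.eventually_nhds] with q h1 h2 h3
    refine ((h1.and_eventually h2.eventually_nhds).and_eventually h3).mono ?_
    rintro q' ⟨⟨h4, h5⟩, h6⟩
    filter_upwards [h5, h6.continuousAt.eventually_ne h4] with w h7 h8
    rw [h7, mul_div_cancel_left₀ _ h8])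
  refine ⟨G, hG, fun z hz => ?_⟩
  refine eq_of_frequently_eq_of_continuousAt (hN z hz).continuousAt
    ((hH z hz).continuousAt.mul (hG z hz).continuousAt) ?_
  rw [← frequently_frequently_nhds]
  refine ((hGf z hz).and_eventually
    ((hH z hz).eventually_frequently_ne (hH0 z hz))).mono ?_
  rintro q ⟨h1, h2⟩
  refine (h2.and_eventually h1).mono ?_
  rintro w ⟨h3, h4⟩
  rw [Pi.mul_apply, ← h4, mul_div_cancel₀ _ h3]

/-! ### The Wronskian in the direction of `z` -/

theorem hasDerivAt_partialZ {f : ℂ × ℂ → ℂ} {q : ℂ × ℂ} (hf : AnalyticAt ℂ f q) :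
    HasDerivAt (fun w => f (w, q.2)) (partialZ f q) q.1 :=
  (AnalyticAt.slice (z := q.1) (c := q.2) hf).differentiableAt.hasDerivAt

theorem analyticAt_partialZ {f : ℂ × ℂ → ℂ} {p : ℂ × ℂ} (hf : AnalyticAt ℂ f p) :
    AnalyticAt ℂ (partialZ f) p := by
  have h : AnalyticAt ℂ (fun q => fderiv ℂ f q (1, 0)) p :=
    ((ContinuousLinearMap.apply ℂ ℂ ((1, 0) : ℂ × ℂ)).analyticAt _).fun_comp hf.fderiv
  refine h.congr ?_
  filter_upwards [hf.eventually_analyticAt] with q hq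
  have h1 : HasDerivAt (fun w : ℂ => (w, q.2)) ((1, 0) : ℂ × ℂ) q.1 :=
    (hasDerivAt_id q.1).prodMk (hasDerivAt_const _ _)
  have h2 : HasFDerivAt f (fderiv ℂ f q) (q.1, q.2) := hq.differentiableAt.hasFDerivAt
  exact (h2.comp_hasDerivAt q.1 h1).deriv.symm

theorem partialZ_eq_of_eventuallyEq {f g : ℂ × ℂ → ℂ} {q : ℂ × ℂ} (h : f =ᶠ[𝓝 q] g) :
    partialZ f q = partialZ g q :=
  EventuallyEq.deriv_eq ((tendsto_slice q).eventually h)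

theorem partialZ_snd_mul (φ : ℂ → ℂ) (f : ℂ × ℂ → ℂ) (q : ℂ × ℂ) :
    partialZ (fun q => φ q.2 * f q) q = φ q.2 * partialZ f q :=
  deriv_const_mul_field (v := fun w => f (w, q.2)) (φ q.2)

/-- The numerator `a_z b - a b_z` of the partial derivative `(a / b)_z`. -/
def wronskianZ (a b : ℂ × ℂ → ℂ) (q : ℂ × ℂ) : ℂ := partialZ a q * b q - a q * partialZ b q

/-- The numerator of `x ^ 3 + δ x ^ 2 + x` at `x = a / b`, multiplied by `b` so that it becomes a
quartic form symmetric in `a` and `b`. -/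
def quartic (a b : ℂ × ℂ → ℂ) (q : ℂ × ℂ) : ℂ := a q * b q * conic q.2 (a q) (b q)

theorem analyticAt_wronskianZ {a b : ℂ × ℂ → ℂ} {p : ℂ × ℂ} (ha : AnalyticAt ℂ a p)
    (hb : AnalyticAt ℂ b p) : AnalyticAt ℂ (wronskianZ a b) p :=
  ((analyticAt_partialZ ha).mul hb).sub (ha.mul (analyticAt_partialZ hb))

theorem wronskianZ_swap (a b : ℂ × ℂ → ℂ) (q : ℂ × ℂ) : wronskianZ b a q = -wronskianZ a b q := by
  unfold wronskianZ; ring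

theorem quartic_swap (a b : ℂ × ℂ → ℂ) (q : ℂ × ℂ) : quartic b a q = quartic a b q := by
  unfold quartic; rw [conic_swap]; ring

theorem eventually_wronskianZ_eq {a b a₁ b₁ : ℂ × ℂ → ℂ} {p : ℂ × ℂ} {c : ℂ} {i j : ℕ}
    (ha : ∀ᶠ q in 𝓝 p, a q = (q.2 - c) ^ i * a₁ q) (hb : ∀ᶠ q in 𝓝 p, b q = (q.2 - c) ^ j * b₁ q) :
    ∀ᶠ q in 𝓝 p, wronskianZ a b q = (q.2 - c) ^ (i + j) * wronskianZ a₁ b₁ q := by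
  filter_upwards [ha.eventually_nhds, hb.eventually_nhds] with q h1 h2
  rw [wronskianZ, partialZ_eq_of_eventuallyEq h1, partialZ_eq_of_eventuallyEq h2,
    partialZ_snd_mul (fun w => (w - c) ^ i), partialZ_snd_mul (fun w => (w - c) ^ j),
    h1.self_of_nhds, h2.self_of_nhds, wronskianZ]
  ring

theorem eventually_nhdsNE_slice {R : ℂ × ℂ → Prop} {p : ℂ × ℂ} (h : ∀ᶠ q in 𝓝 p, R q) :
    ∀ᶠ z in 𝓝[≠] p.1, ∀ᶠ q in 𝓝 (z, p.2), R q :=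
  ((tendsto_slice p).mono_left nhdsWithin_le_nhds).eventually h.eventually_nhds

/-- Comparison of two functions through their orders along the line `δ = c`; only `F` needs to have
the order `j` exactly. -/
theorem exists_norm_sq_le {W F w f : ℂ × ℂ → ℂ} {z c : ℂ} {i j : ℕ} (hij : j ≤ 2 * i)
    (hw : ContinuousAt w (z, c)) (hf : ContinuousAt f (z, c)) (hf0 : f (z, c) ≠ 0)
    (hW : ∀ᶠ q in 𝓝 (z, c), W q = (q.2 - c) ^ i * w q)
    (hF : ∀ᶠ q in 𝓝 (z, c), F q = (q.2 - c) ^ j * f q) :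
    ∃ C : ℝ, ∀ᶠ q in 𝓝 (z, c), ‖W q‖ ^ 2 ≤ C * ‖F q‖ := by
  have hq : ContinuousAt (fun q => ‖w q ^ 2 / f q‖) (z, c) := ((hw.pow 2).div hf hf0).norm
  have hb := hq.eventually_lt continuousAt_const (lt_add_one _)
  have ht : ∀ᶠ q : ℂ × ℂ in 𝓝 (z, c), ‖q.2 - c‖ < 1 := by
    have : ContinuousAt (fun q : ℂ × ℂ => ‖q.2 - c‖) (z, c) := by fun_prop
    exact this.eventually_lt continuousAt_const (by simp)
  refine ⟨‖w (z, c) ^ 2 / f (z, c)‖ + 1, ?_⟩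
  filter_upwards [hb, ht, hW, hF, hf.eventually_ne hf0] with q h1 h2 h3 h4 h5
  have h6 : ‖w q‖ ^ 2 = ‖w q ^ 2 / f q‖ * ‖f q‖ := by
    rw [← norm_mul, div_mul_cancel₀ _ h5, norm_pow]
  calc ‖W q‖ ^ 2 = ‖q.2 - c‖ ^ (2 * i) * (‖w q ^ 2 / f q‖ * ‖f q‖) := by
        rw [h3, norm_mul, mul_pow, h6, norm_pow]; ring
    _ ≤ ‖q.2 - c‖ ^ j * ((‖w (z, c) ^ 2 / f (z, c)‖ + 1) * ‖f q‖) := by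
        gcongr ?_ * (?_ * _)
        exact pow_le_pow_of_le_one (norm_nonneg _) h2.le hij
    _ = (‖w (z, c) ^ 2 / f (z, c)‖ + 1) * ‖F q‖ := by
        rw [h4, norm_mul, norm_pow]; ring

/-- The bound of `exists_norm_wronskianZ_sq_le` in the affine chart where `b` is not divisible by
`δ - p.2`. -/
theorem exists_norm_wronskianZ_sq_le_of_ne {a b : ℂ × ℂ → ℂ} {p : ℂ × ℂ}
    (ha : AnalyticAt ℂ a p) (hb : AnalyticAt ℂ b p)
    (hb0 : ∀ᶠ z in 𝓝[≠] p.1, b (z, p.2) ≠ 0) (hF : ∃ᶠ q in 𝓝 p, quartic a b q ≠ 0) :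
    ∀ᶠ z in 𝓝[≠] p.1, ∃ C : ℝ, ∀ᶠ q in 𝓝 (z, p.2),
      ‖wronskianZ a b q‖ ^ 2 ≤ C * ‖quartic a b q‖ := by
  set Q : ℂ × ℂ → ℂ := fun q => conic q.2 (a q) (b q) with hQ
  have hQa : AnalyticAt ℂ Q p := analyticAt_conic analyticAt_snd ha hb
  have ha0 : ∃ᶠ q in 𝓝 p, a q ≠ 0 :=
    hF.mono fun q h => left_ne_zero_of_mul (left_ne_zero_of_mul h)
  have hQ0 : ∃ᶠ q in 𝓝 p, Q q ≠ 0 := hF.mono fun q h => right_ne_zero_of_mul h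
  have haA := eventually_nhdsNE_slice ha.eventually_analyticAt
  have hbA := eventually_nhdsNE_slice hb.eventually_analyticAt
  obtain ⟨m, a₁, ha₁, ha₁0, haa⟩ := exists_eq_pow_mul ha ha0
  have haaS := eventually_nhdsNE_slice haa
  rcases Nat.eq_zero_or_pos m with hm | hm
  · have haz : ∀ᶠ z in 𝓝[≠] p.1, a (z, p.2) ≠ 0 := by
      filter_upwards [ha₁0, haaS] with z h1 h2
      rw [h2.self_of_nhds, hm]
      simpa using h1
    rcases (AnalyticAt.slice (z := p.1) (c := p.2) hQa).eventually_eq_zero_or_eventually_ne_zero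
      with hQz | hQz
    · by_cases hc : p.2 ^ 2 = 4
      · -- Here `Q = s ^ 2 + (δ - c) a b` with `s = a + (c / 2) b` divisible by `δ - c`, so that
        -- `Q` vanishes to order exactly one along the line.
        set s : ℂ × ℂ → ℂ := fun q => a q + p.2 / 2 * b q with hs
        have hsa : AnalyticAt ℂ s p := ha.fun_add (analyticAt_const.fun_mul hb)
        have hs0 : ∀ᶠ z in 𝓝 p.1, s (z, p.2) = 0 := by
          filter_upwards [hQz] with z hz
          have : s (z, p.2) ^ 2 = 0 := by
            simp only [hQ, conic] at hz
            simp only [hs]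
            linear_combination hz + b (z, p.2) ^ 2 / 4 * hc
          exact pow_eq_zero_iff two_ne_zero |>.1 this
        obtain ⟨h, hh, hsh⟩ := exists_eq_snd_sub_mul hsa hs0
        have hW := eventually_nhdsNE_slice (eventually_wronskianZ_eq (c := p.2) (i := 1) (j := 0)
          (a := s) (b := b) (a₁ := h) (b₁ := b) (by simpa using hsh) (by simp))
        filter_upwards [haz, hb0, haA, hbA, hW, eventually_nhdsNE_slice hsh,
          eventually_nhdsNE_slice hh.eventually_analyticAt] with z h1 h2 h3 h4 h5 h6 h7
        have h3' := h3.self_of_nhds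
        have h4' := h4.self_of_nhds
        have h7' := h7.self_of_nhds
        have hf : AnalyticAt ℂ
            (fun q : ℂ × ℂ => a q * b q * ((q.2 - p.2) * h q ^ 2 + a q * b q)) (z, p.2) :=
          (h3'.fun_mul h4').fun_mul (((analyticAt_snd_sub _ _).fun_mul (h7'.fun_pow 2)).fun_add
            (h3'.fun_mul h4'))
        refine exists_norm_sq_le (i := 1) (j := 1) (by norm_num)
          (analyticAt_wronskianZ h7' h4').continuousAt hf.continuousAt ?_ ?_ ?_
        · simp [h1, h2]
        · filter_upwards [h3, h4, h5] with q hq1 hq2 hq3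
          have e : partialZ s q = partialZ a q + p.2 / 2 * partialZ b q :=
            ((hasDerivAt_partialZ hq1).fun_add ((hasDerivAt_partialZ hq2).const_mul _)).deriv
          rw [add_zero] at hq3
          rw [← hq3]
          simp only [wronskianZ, e]
          simp only [hs]
          ring
        · filter_upwards [h6] with q hq
          have e : a q = (q.2 - p.2) * h q - p.2 / 2 * b q := by
            rw [← hq]; simp [hs]
          simp only [quartic, conic]
          rw [e]
          linear_combination (-(((q.2 - p.2) * h q - p.2 / 2 * b q) * b q * b q ^ 2 / 4)) * hc
      · -- Here `2 a + δ b` is a unit, and `(2 a + δ b) W = b Q_z - 2 b_z Q`.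
        obtain ⟨n, Q₁, hQ₁, hQ₁0, hQQ⟩ := exists_eq_pow_mul hQa hQ0
        filter_upwards [haz, hb0, haA, hbA, hQ₁0, (eventually_nhdsNE_slice hQQ),
          (eventually_nhdsNE_slice hQ₁.eventually_analyticAt),
          hQz.filter_mono nhdsWithin_le_nhds] with z h1 h2 h3 h4 h5 h6 h7 h8
        have h3' := h3.self_of_nhds
        have h4' := h4.self_of_nhds
        have h7' := h7.self_of_nhds
        have hl : AnalyticAt ℂ (fun q : ℂ × ℂ => 2 * a q + q.2 * b q) (z, p.2) :=
          (analyticAt_const.fun_mul h3').fun_add (analyticAt_snd.fun_mul h4')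
        have hl0 : 2 * a (z, p.2) + p.2 * b (z, p.2) ≠ 0 := two_mul_add_ne_zero hc h2 h8
        have hw : AnalyticAt ℂ (fun q : ℂ × ℂ =>
            (b q * partialZ Q₁ q - 2 * partialZ b q * Q₁ q) / (2 * a q + q.2 * b q)) (z, p.2) :=
          ((h4'.fun_mul (analyticAt_partialZ h7')).fun_sub
            ((analyticAt_const.fun_mul (analyticAt_partialZ h4')).fun_mul h7')).fun_div hl hl0
        refine exists_norm_sq_le (i := n) (j := n) (by omega) hw.continuousAt
          (f := fun q => a q * b q * Q₁ q)
          ((h3'.fun_mul h4').fun_mul h7').continuousAt (by simp [h1, h2, h5]) ?_ ?_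
        · filter_upwards [h3, h4, h6.eventually_nhds, hl.continuousAt.eventually_ne hl0]
            with q hq1 hq2 hq3 hq4
          have d1 := hasDerivAt_partialZ hq1
          have d2 := hasDerivAt_partialZ hq2
          have e1 : partialZ Q q = 2 * a q * partialZ a q + (q.2 * partialZ a q * b q
              + q.2 * a q * partialZ b q) + 2 * b q * partialZ b q := by
            have := ((d1.fun_pow 2).fun_add ((d1.const_mul q.2).fun_mul d2)).fun_add (d2.fun_pow 2)
            refine (this.congr_deriv ?_).deriv
            simp
          have e2 : partialZ Q q = (q.2 - p.2) ^ n * partialZ Q₁ q := by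
            rw [partialZ_eq_of_eventuallyEq hq3]
            exact partialZ_snd_mul (fun w => (w - p.2) ^ n) Q₁ q
          have e3 : conic q.2 (a q) (b q) = (q.2 - p.2) ^ n * Q₁ q := hq3.self_of_nhds
          rw [← mul_div_assoc, eq_div_iff hq4, wronskianZ]
          unfold conic at e3
          linear_combination b q * e2 - b q * e1 - 2 * partialZ b q * e3
        · filter_upwards [h6] with q hq
          have e3 : conic q.2 (a q) (b q) = (q.2 - p.2) ^ n * Q₁ q := hq
          rw [quartic, e3]
          ring
    · filter_upwards [haz, hb0, haA, hbA, hQz] with z h1 h2 h3 h4 h5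
      have h3' := h3.self_of_nhds
      have h4' := h4.self_of_nhds
      refine exists_norm_sq_le (i := 0) (j := 0) le_rfl
        (analyticAt_wronskianZ h3' h4').continuousAt (f := quartic a b)
        ((h3'.fun_mul h4').fun_mul (analyticAt_conic analyticAt_snd h3' h4')).continuousAt
        (mul_ne_zero (mul_ne_zero h1 h2) h5) ?_ ?_ <;> simp
  · have hW := eventually_nhdsNE_slice (eventually_wronskianZ_eq (c := p.2) (i := m) (j := 0)
      (b := b) (b₁ := b) haa (by simp))
    filter_upwards [ha₁0, hb0, haA, hbA, hW, haaS,
      eventually_nhdsNE_slice ha₁.eventually_analyticAt] with z h1 h2 h3 h4 h5 h6 h7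
    have h3' := h3.self_of_nhds
    have h4' := h4.self_of_nhds
    have h7' := h7.self_of_nhds
    have haz : a (z, p.2) = 0 := by
      rw [h6.self_of_nhds]; simp [hm.ne']
    refine exists_norm_sq_le (i := m) (j := m) (by omega)
      (analyticAt_wronskianZ h7' h4').continuousAt (f := fun q => a₁ q * b q * Q q)
      ((h7'.fun_mul h4').fun_mul (analyticAt_conic analyticAt_snd h3' h4')).continuousAt ?_ h5 ?_
    · simp [h1, h2, hQ, conic, haz]
    · filter_upwards [h6] with q hq
      simp only [quartic, hQ]
      nth_rewrite 1 [hq]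
      ring

theorem exists_norm_wronskianZ_sq_le_of_scaled {a b a₁ b₁ : ℂ × ℂ → ℂ} {p : ℂ × ℂ} {k : ℕ}
    (haa : ∀ᶠ q in 𝓝 p, a q = (q.2 - p.2) ^ k * a₁ q)
    (hbb : ∀ᶠ q in 𝓝 p, b q = (q.2 - p.2) ^ k * b₁ q)
    (h : ∀ᶠ z in 𝓝[≠] p.1, ∃ C : ℝ, ∀ᶠ q in 𝓝 (z, p.2),
      ‖wronskianZ a₁ b₁ q‖ ^ 2 ≤ C * ‖quartic a₁ b₁ q‖) :
    ∀ᶠ z in 𝓝[≠] p.1, ∃ C : ℝ, ∀ᶠ q in 𝓝 (z, p.2),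
      ‖wronskianZ a b q‖ ^ 2 ≤ C * ‖quartic a b q‖ := by
  filter_upwards [h, eventually_nhdsNE_slice haa, eventually_nhdsNE_slice hbb,
    eventually_nhdsNE_slice (eventually_wronskianZ_eq haa hbb)] with z hz h1 h2 h3
  obtain ⟨C, hC⟩ := hz
  refine ⟨C, ?_⟩
  filter_upwards [hC, h1, h2, h3] with q hq hq1 hq2 hq3
  have e : quartic a b q = (q.2 - p.2) ^ (4 * k) * quartic a₁ b₁ q := by
    simp only [quartic, conic, hq1, hq2]; ring
  calc ‖wronskianZ a b q‖ ^ 2 = ‖q.2 - p.2‖ ^ (4 * k) * ‖wronskianZ a₁ b₁ q‖ ^ 2 := by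
        rw [hq3, norm_mul, norm_pow]; ring
    _ ≤ ‖q.2 - p.2‖ ^ (4 * k) * (C * ‖quartic a₁ b₁ q‖) := by gcongr
    _ = C * ‖quartic a b q‖ := by rw [e, norm_mul, norm_pow]; ring

/-- Near a general point of the line `δ = p.2`, even if the fibre over it is singular,
`|x_z| ^ 2` is at most a constant times `|x ^ 3 + δ x ^ 2 + x|`, where `x = a / b`. -/
theorem exists_norm_wronskianZ_sq_le {a b : ℂ × ℂ → ℂ} {p : ℂ × ℂ}
    (ha : AnalyticAt ℂ a p) (hb : AnalyticAt ℂ b p) (hF : ∃ᶠ q in 𝓝 p, quartic a b q ≠ 0) :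
    ∀ᶠ z in 𝓝[≠] p.1, ∃ C : ℝ, ∀ᶠ q in 𝓝 (z, p.2),
      ‖wronskianZ a b q‖ ^ 2 ≤ C * ‖quartic a b q‖ := by
  -- The claim is symmetric in `a` and `b`, so `b` may be taken of the smaller order.
  have key : ∀ {a b a₁ b₁ : ℂ × ℂ → ℂ} {i j : ℕ}, AnalyticAt ℂ a₁ p → AnalyticAt ℂ b₁ p →
      (∀ᶠ z in 𝓝[≠] p.1, b₁ (z, p.2) ≠ 0) → (∀ᶠ q in 𝓝 p, a q = (q.2 - p.2) ^ i * a₁ q) →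
      (∀ᶠ q in 𝓝 p, b q = (q.2 - p.2) ^ j * b₁ q) → j ≤ i → (∃ᶠ q in 𝓝 p, quartic a b q ≠ 0) →
      ∀ᶠ z in 𝓝[≠] p.1, ∃ C : ℝ, ∀ᶠ q in 𝓝 (z, p.2),
        ‖wronskianZ a b q‖ ^ 2 ≤ C * ‖quartic a b q‖ := by
    intro a b a₁ b₁ i j ha₁ hb₁ hb₁0 haa hbb hij hF
    have haa' : ∀ᶠ q in 𝓝 p, a q = (q.2 - p.2) ^ j * ((q.2 - p.2) ^ (i - j) * a₁ q) := by
      filter_upwards [haa] with q hq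
      rw [hq, ← mul_assoc, ← pow_add, Nat.add_sub_cancel' hij]
    refine exists_norm_wronskianZ_sq_le_of_scaled haa' hbb ?_
    refine exists_norm_wronskianZ_sq_le_of_ne (((analyticAt_snd_sub _ _).fun_pow _).fun_mul ha₁)
      hb₁ hb₁0 ?_
    refine (hF.and_eventually (haa'.and hbb)).mono ?_
    rintro q ⟨h1, h2, h3⟩ h4
    refine h1 ?_
    simp only [quartic, conic] at h4 ⊢
    rw [h2, h3]
    linear_combination (q.2 - p.2) ^ (4 * j) * h4
  obtain ⟨i, a₁, ha₁, ha₁0, haa⟩ := exists_eq_pow_mul ha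
    (hF.mono fun q h => left_ne_zero_of_mul (left_ne_zero_of_mul h))
  obtain ⟨j, b₁, hb₁, hb₁0, hbb⟩ := exists_eq_pow_mul hb
    (hF.mono fun q h => right_ne_zero_of_mul (left_ne_zero_of_mul h))
  rcases le_total j i with hij | hij
  · exact key ha₁ hb₁ hb₁0 haa hbb hij hF
  · have := key hb₁ ha₁ ha₁0 hbb haa hij (by simpa only [quartic_swap] using hF)
    simpa only [wronskianZ_swap a b, quartic_swap a b, norm_neg] using this

/-! ### Extension across the zeros of the denominator -/

/-- A bound by a power of `δ - p.2`, near general points of the line `δ = p.2` only, implies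
divisibility by that power at `p`. -/
theorem exists_eq_pow_mul_of_bound {G : ℂ × ℂ → ℂ} {p : ℂ × ℂ} (hG : AnalyticAt ℂ G p) {n : ℕ}
    (h : ∀ᶠ z in 𝓝[≠] p.1, ∃ C : ℝ, ∀ᶠ q in 𝓝 (z, p.2), ‖G q‖ ^ 2 ≤ C * ‖q.2 - p.2‖ ^ (2 * n)) :
    ∃ g : ℂ × ℂ → ℂ, AnalyticAt ℂ g p ∧ ∀ᶠ q in 𝓝 p, G q = (q.2 - p.2) ^ n * g q := by
  by_cases hG0 : ∃ᶠ q in 𝓝 p, G q ≠ 0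
  swap
  · refine ⟨fun _ => 0, analyticAt_const, ?_⟩
    filter_upwards [not_frequently.1 hG0] with q hq
    simpa using hq
  obtain ⟨m, g, hg, hg0, hGg⟩ := exists_eq_pow_mul hG hG0
  rcases le_or_gt n m with hnm | hnm
  · refine ⟨fun q => (q.2 - p.2) ^ (m - n) * g q,
      ((analyticAt_snd_sub _ _).fun_pow _).fun_mul hg, ?_⟩
    filter_upwards [hGg] with q hq
    rw [hq, ← mul_assoc, ← pow_add, Nat.add_sub_cancel' hnm]
  exfalso
  obtain ⟨z, ⟨C, hC⟩, hz0, hGz, hgz⟩ := (h.and (hg0.and ((eventually_nhdsNE_slice hGg).and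
    (eventually_nhdsNE_slice hg.eventually_analyticAt)))).exists
  have hle : ∃ᶠ q in 𝓝 (z, p.2), ‖g q‖ ^ 2 ≤ C * ‖q.2 - p.2‖ ^ (2 * (n - m)) := by
    refine ((frequently_snd_ne (z, p.2)).and_eventually (hC.and hGz)).mono ?_
    rintro q ⟨h1, h2, h3⟩
    have hpos : 0 < ‖q.2 - p.2‖ ^ (2 * m) := pow_pos (norm_pos_iff.2 h1) _
    refine le_of_mul_le_mul_left ?_ hpos
    calc ‖q.2 - p.2‖ ^ (2 * m) * ‖g q‖ ^ 2 = ‖G q‖ ^ 2 := by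
          rw [h3, norm_mul, norm_pow]; ring
      _ ≤ C * ‖q.2 - p.2‖ ^ (2 * n) := h2
      _ = ‖q.2 - p.2‖ ^ (2 * m) * (C * ‖q.2 - p.2‖ ^ (2 * (n - m))) := by
          rw [show 2 * n = 2 * m + 2 * (n - m) by omega, pow_add]; ring
  have hcR : ContinuousAt (fun q : ℂ × ℂ => C * ‖q.2 - p.2‖ ^ (2 * (n - m))) (z, p.2) := by
    fun_prop
  have hlim := le_of_tendsto_of_tendsto_of_frequently
    ((hgz.self_of_nhds.continuousAt.norm.pow 2).tendsto) hcR.tendsto hle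
  have hn : 2 * (n - m) ≠ 0 := by omega
  simp only [sub_self, norm_zero, zero_pow hn, mul_zero] at hlim
  exact hz0 (norm_eq_zero.1 (pow_eq_zero_iff two_ne_zero |>.1
    (le_antisymm hlim (by positivity))))

theorem eventually_sq_ne_four (c : ℂ) : ∀ᶠ w in 𝓝 c, w - c ≠ 0 → w ^ 2 ≠ 4 := by
  have hfin : ({2, -2} \ {c} : Set ℂ).Finite := (Set.toFinite {2, -2}).sdiff
  filter_upwards [hfin.isClosed.isOpen_compl.mem_nhds (by simp : c ∈ ({2, -2} \ {c} : Set ℂ)ᶜ)]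
    with w hw hwc h4
  refine hw ⟨?_, fun h => hwc (sub_eq_zero.2 h)⟩
  have : (w - 2) * (w + 2) = 0 := by linear_combination h4
  rcases mul_eq_zero.1 this with h | h
  · exact Or.inl (sub_eq_zero.1 h)
  · exact Or.inr (eq_neg_of_add_eq_zero_left h)

/-- The local form of the result: `x_z / y` extends analytically to the point `p`, where
`x = a / b` and `y = c / d`. -/
theorem exists_eventually_wronskianZ_mul_eq {P a b c d : ℂ × ℂ → ℂ} {p : ℂ × ℂ}
    (hP : AnalyticAt ℂ P p) (ha : AnalyticAt ℂ a p) (hb : AnalyticAt ℂ b p)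
    (hc : AnalyticAt ℂ c p) (hd : AnalyticAt ℂ d p) (hP0 : ∃ᶠ q in 𝓝 p, P q ≠ 0)
    (hb0 : ∃ᶠ q in 𝓝 p, b q ≠ 0) (hc0 : ∃ᶠ q in 𝓝 p, c q ≠ 0)
    (h : ∀ᶠ q in 𝓝 p, P q * c q ^ 2 * b q ^ 3 = d q ^ 2 * (a q * conic q.2 (a q) (b q))) :
    ∃ g : ℂ × ℂ → ℂ, AnalyticAt ℂ g p ∧
      ∀ᶠ q in 𝓝 p, wronskianZ a b q * d q = b q ^ 2 * c q * g q := by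
  have hHa : AnalyticAt ℂ (fun q => b q ^ 2 * c q) p := (hb.fun_pow 2).fun_mul hc
  have hH0 : ∃ᶠ q in 𝓝 p, b q ^ 2 * c q ≠ 0 :=
    (hb.fun_pow 2).frequently_mul_ne hc (hb0.mono fun _ hq => pow_ne_zero 2 hq) hc0
  have hF0 : ∃ᶠ q in 𝓝 p, quartic a b q ≠ 0 := by
    refine ((hP.frequently_mul_ne (hHa.fun_pow 2) hP0
      (hH0.mono fun _ hq => pow_ne_zero 2 hq)).and_eventually h).mono ?_
    rintro q ⟨h1, h2⟩ h3
    refine h1 ?_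
    unfold quartic at h3
    linear_combination b q * h2 + d q ^ 2 * h3
  have hW := analyticAt_wronskianZ ha hb
  obtain ⟨n, H, hH, hHz, hHH⟩ := exists_eq_pow_mul hHa hH0
  obtain ⟨R, hR, hball⟩ := Metric.eventually_nhds_iff_ball.1
    ((ha.eventually_analyticAt.and hb.eventually_analyticAt).and
      ((hc.eventually_analyticAt.and hd.eventually_analyticAt).and
        ((hP.eventually_analyticAt.and hH.eventually_analyticAt).and (h.and hHH))))
  obtain ⟨ε, hε, hHε⟩ := Metric.eventually_nhds_iff_ball.1 (eventually_nhdsWithin_iff.1 hHz)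
  obtain ⟨r, hr, hrRε⟩ := exists_between (lt_min hR hε)
  have hrR : r < R := hrRε.trans_le (min_le_left _ _)
  have hrε : r < ε := hrRε.trans_le (min_le_right _ _)
  have hmem : ∀ z ∈ Metric.ball p.1 R, ∀ w ∈ Metric.ball p.2 R, (z, w) ∈ Metric.ball p R := by
    intro z hz w hw
    rw [Metric.mem_ball, Prod.dist_eq]
    exact max_lt hz hw
  have hclosed : Metric.closedBall p.1 r ⊆ Metric.ball p.1 R :=
    Metric.closedBall_subset_ball hrR
  have hsph : ∀ ζ ∈ Metric.sphere p.1 r, H (ζ, p.2) ≠ 0 := fun ζ hζ =>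
    hHε ζ (by rw [Metric.mem_ball, Metric.mem_sphere.1 hζ]; exact hrε)
      (Metric.ne_of_mem_sphere hζ hr.ne')
  have hsphR : ∀ ζ ∈ Metric.sphere p.1 r, (ζ, p.2) ∈ Metric.ball p R := fun ζ hζ =>
    hmem ζ (hclosed (Metric.sphere_subset_closedBall hζ)) _ (Metric.mem_ball_self hR)
  set F₀ : ℂ × ℂ → ℂ := fun q => wronskianZ a b q * d q / H q with hF₀
  have hF₀a : ∀ ζ ∈ Metric.sphere p.1 r, AnalyticAt ℂ F₀ (ζ, p.2) := by
    intro ζ hζ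
    obtain ⟨⟨h1, h2⟩, ⟨-, h4⟩, ⟨-, h6⟩, -⟩ := hball _ (hsphR ζ hζ)
    exact ((analyticAt_wronskianZ h1 h2).fun_mul h4).fun_div h6 (hsph ζ hζ)
  set G : ℂ × ℂ → ℂ := fun q => (2 * Real.pi * Complex.I : ℂ)⁻¹ •
    ∮ ζ in C(p.1, r), (ζ - q.1)⁻¹ • F₀ (ζ, q.2) with hG
  have hGa : AnalyticAt ℂ G p := analyticAt_cauchyIntegral hF₀a (Metric.mem_ball_self hr)
  have hHcirc : ∀ᶠ w in 𝓝 p.2, ∀ ζ ∈ Metric.sphere p.1 r, H (ζ, w) ≠ 0 := by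
    refine (isCompact_sphere p.1 r).eventually_forall_of_forall_eventually fun ζ hζ => ?_
    have ht : Tendsto (fun q : ℂ × ℂ => (q.2, q.1)) (𝓝 (p.2, ζ)) (𝓝 (ζ, p.2)) :=
      (continuous_snd.prodMk continuous_fst).tendsto (p.2, ζ)
    obtain ⟨-, -, ⟨-, h6⟩, -⟩ := hball _ (hsphR ζ hζ)
    exact ht.eventually (h6.continuousAt.eventually_ne (hsph ζ hζ))
  -- On each slice `δ = w`, `w ≠ p.2`, the quotient `F₀` is analytic in the disc, hence given by
  -- its Cauchy integral.
  have hslice : ∀ᶠ q in 𝓝 p, q.2 - p.2 ≠ 0 → H q * G q - wronskianZ a b q * d q = 0 := by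
    have t1 := (continuous_fst.tendsto p).eventually (Metric.ball_mem_nhds p.1 hr)
    have t2 := (continuous_snd.tendsto p).eventually (Metric.ball_mem_nhds p.2 hR)
    have t3 := (continuous_snd.tendsto p).eventually hHcirc
    have t4 := (continuous_snd.tendsto p).eventually (eventually_sq_ne_four p.2)
    filter_upwards [t1, t2, t3, t4] with q hq1 hq2 hq3 hq4 hq5
    have hδ := hq4 hq5
    have hin : ∀ z ∈ Metric.ball p.1 R, (z, q.2) ∈ Metric.ball p R := fun z hz => hmem z hz _ hq2
    have hHs : AnalyticOnNhd ℂ (fun z => H (z, q.2)) (Metric.ball p.1 R) := fun z hz =>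
      (hball _ (hin z hz)).2.2.1.2.slice
    have hNs : AnalyticOnNhd ℂ (fun z => wronskianZ a b (z, q.2) * d (z, q.2))
        (Metric.ball p.1 R) := fun z hz => by
      obtain ⟨⟨h1, h2⟩, ⟨-, h4⟩, -, -⟩ := hball _ (hin z hz)
      exact ((analyticAt_wronskianZ h1 h2).fun_mul h4).slice
    have hcirc : p.1 + r ∈ Metric.sphere p.1 r := by simp [hr.le]
    have hcircR : p.1 + r ∈ Metric.ball p.1 R :=
      hclosed (Metric.sphere_subset_closedBall hcirc)
    have hHfr : ∀ z ∈ Metric.ball p.1 R, ∃ᶠ w in 𝓝 z, H (w, q.2) ≠ 0 := fun z hz hcon =>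
      hq3 _ hcirc (hHs.eqOn_zero_of_preconnected_of_eventuallyEq_zero
        (convex_ball p.1 R).isPreconnected hz
        (by filter_upwards [hcon] with w hw using not_not.1 hw) hcircR)
    obtain ⟨Γ, hΓ, hΓH⟩ := exists_analyticOnNhd_quotient Metric.isOpen_ball
      (convex_ball p.1 R).isPreconnected hNs hHs hcircR (hq3 _ hcirc) (by
        intro z hz
        obtain ⟨⟨h1, h2⟩, ⟨h3, h4⟩, ⟨h5, h6⟩, -⟩ := hball _ (hin z hz)
        have hnear : ∀ᶠ w in 𝓝 z, w ∈ Metric.ball p.1 R := Metric.isOpen_ball.mem_nhds hz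
        obtain ⟨g, hg, hgN⟩ := exists_eventually_eq_mul_of_slice hδ h5.slice h1.slice h2.slice
          h3.slice h4.slice
          (by
            refine ((hHfr z hz).and_eventually hnear).mono ?_
            rintro w ⟨hw1, hw2⟩
            rw [(hball _ (hin w hw2)).2.2.2.2]
            exact mul_ne_zero (pow_ne_zero n hq5) hw1)
          (by
            filter_upwards [hnear] with w hw
            exact (hball _ (hin w hw)).2.2.2.1)
        refine ⟨fun w => (q.2 - p.2) ^ n * g w, analyticAt_const.fun_mul hg, ?_⟩
        filter_upwards [hgN, hnear] with w hw1 hw2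
        have e := (hball _ (hin w hw2)).2.2.2.2
        rw [e] at hw1
        refine Eq.trans hw1 ?_
        ring)
    have hcauchy : G q = Γ q.1 := by
      rw [← cauchyIntegral_eq (fun z hz => hΓ z (hclosed hz)) hq1]
      simp only [hG]
      congr 1
      refine circleIntegral.integral_congr hr.le fun ζ hζ => ?_
      have := hΓH ζ (hclosed (Metric.sphere_subset_closedBall hζ))
      simp only [hF₀, this, mul_div_cancel_left₀ _ (hq3 ζ hζ)]
    have := hΓH q.1 (hclosed (Metric.ball_subset_closedBall hq1))
    rw [hcauchy, sub_eq_zero]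
    exact this.symm
  have hHG : ∀ᶠ q in 𝓝 p, H q * G q - wronskianZ a b q * d q = 0 :=
    eventually_eq_zero_of_off_line ((hH.fun_mul hGa).fun_sub (hW.fun_mul hd)) hslice
  -- It remains to divide `G` by the power of `δ - p.2` contained in `b ^ 2 c`.
  obtain ⟨g, hg, hgG⟩ := exists_eq_pow_mul_of_bound (n := n) hGa (by
    have hPb : ∀ᶠ q in 𝓝 p, ‖P q‖ < ‖P p‖ + 1 :=
      hP.continuousAt.norm.eventually_lt continuousAt_const (lt_add_one _)
    filter_upwards [exists_norm_wronskianZ_sq_le ha hb hF0, hHz, eventually_nhdsNE_slice hHG,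
      eventually_nhdsNE_slice h, eventually_nhdsNE_slice hHH, eventually_nhdsNE_slice hPb,
      eventually_nhdsNE_slice hH.eventually_analyticAt] with z hz1 hz2 hz3 hz4 hz5 hz6 hz7
    obtain ⟨C, hC⟩ := hz1
    refine ⟨|C| * (‖P p‖ + 1), ?_⟩
    filter_upwards [hC, hz3, hz4, hz5, hz6, hz7.self_of_nhds.continuousAt.eventually_ne hz2]
      with q h1 h2 h3 h4 h5 h6
    have hpos : 0 < ‖H q‖ ^ 2 := pow_pos (norm_pos_iff.2 h6) _
    refine le_of_mul_le_mul_left ?_ hpos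
    have e1 : d q ^ 2 * quartic a b q = P q * ((q.2 - p.2) ^ n * H q) ^ 2 := by
      rw [← h4, quartic]
      linear_combination -b q * h3
    calc ‖H q‖ ^ 2 * ‖G q‖ ^ 2 = ‖d q‖ ^ 2 * ‖wronskianZ a b q‖ ^ 2 := by
          rw [← mul_pow, ← norm_mul, sub_eq_zero.1 h2, norm_mul]; ring
      _ ≤ ‖d q‖ ^ 2 * (|C| * ‖quartic a b q‖) := by
          gcongr
          exact h1.trans (by gcongr; exact le_abs_self C)
      _ = |C| * ‖d q ^ 2 * quartic a b q‖ := by rw [norm_mul, norm_pow]; ring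
      _ = |C| * ‖P q‖ * (‖H q‖ ^ 2 * ‖q.2 - p.2‖ ^ (2 * n)) := by
          rw [e1, norm_mul, norm_pow, norm_mul, norm_pow]; ring
      _ ≤ |C| * (‖P p‖ + 1) * (‖H q‖ ^ 2 * ‖q.2 - p.2‖ ^ (2 * n)) := by gcongr
      _ = ‖H q‖ ^ 2 * (|C| * (‖P p‖ + 1) * ‖q.2 - p.2‖ ^ (2 * n)) := by ring)
  refine ⟨g, hg, ?_⟩
  filter_upwards [hHG, hgG, hHH] with q h1 h2 h3
  rw [h3, ← sub_eq_zero.1 h1, h2]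
  ring

/-! ### From germs to functions near `B` -/

/-- An identity between analytic germs may be checked on a dense set. -/
theorem eventually_eq_of_frequently_eq {E : Type*} [NormedAddCommGroup E] [NormedSpace ℂ E]
    {f g : E → ℂ} {p : E} (hf : AnalyticAt ℂ f p) (hg : AnalyticAt ℂ g p)
    (h : ∀ᶠ q in 𝓝 p, ∃ᶠ q' in 𝓝 q, f q' = g q') : ∀ᶠ q in 𝓝 p, f q = g q := by
  filter_upwards [hf.eventually_analyticAt, hg.eventually_analyticAt, h] with q h1 h2 h3
  exact eq_of_frequently_eq_of_continuousAt h1.continuousAt h2.continuousAt h3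

theorem frequently_cubic_ne_zero (p : ℂ × ℂ) :
    ∃ᶠ q : ℂ × ℂ in 𝓝 p, q.1 ^ 3 + q.2 * q.1 ^ 2 + q.1 ≠ 0 := by
  -- For fixed `z ≠ 0` the cubic is a polynomial of degree one in `δ`.
  have hfst : ∃ᶠ q : ℂ × ℂ in 𝓝 p, q.1 - p.1 ≠ 0 := by
    have h : ∃ᶠ w in 𝓝[≠] p.1, w - p.1 ≠ 0 := Eventually.frequently (by
      filter_upwards [self_mem_nhdsWithin] with w hw using sub_ne_zero.2 hw)
    exact ((tendsto_slice p).mono_left nhdsWithin_le_nhds).frequently h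
  have hfst0 : ∃ᶠ q : ℂ × ℂ in 𝓝 p, q.1 ≠ 0 := by
    by_cases h0 : p.1 = 0
    · simpa [h0] using hfst
    · exact (continuous_fst.continuousAt.eventually_ne h0).frequently
  rw [← frequently_frequently_nhds]
  refine hfst0.mono fun q hq hcon => ?_
  have hcon' : ∀ᶠ w in 𝓝 q.2, q.1 ^ 3 + w * q.1 ^ 2 + q.1 = 0 := by
    have ht : Tendsto (fun w : ℂ => (q.1, w)) (𝓝 q.2) (𝓝 q) := by
      have : Continuous fun w : ℂ => (q.1, w) := by fun_prop
      exact this.tendsto q.2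
    filter_upwards [ht.eventually hcon] with w hw using not_not.1 hw
  have hne : ∃ᶠ w in 𝓝[≠] q.2, w ≠ q.2 := Eventually.frequently (by
    filter_upwards [self_mem_nhdsWithin] with w hw using hw)
  obtain ⟨w, hw, hw'⟩ :=
    ((hne.filter_mono nhdsWithin_le_nhds).and_eventually hcon').exists
  have : (w - q.2) * q.1 ^ 2 = 0 := by linear_combination hw' - hcon'.self_of_nhds
  rcases mul_eq_zero.1 this with h | h
  · exact hw (sub_eq_zero.1 h)
  · exact hq (pow_eq_zero_iff two_ne_zero |>.1 h)

/-- Near every point, `x_z / y` agrees generically with an analytic function. If `y` vanishes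
identically near the point, then so does the pointwise quotient. -/
theorem exists_analyticAt_eq_partialZ_div {x y : ℂ × ℂ → ℂ} {p : ℂ × ℂ}
    (hx : IsMeromorphicAt x p) (hy : IsMeromorphicAt y p)
    (h : ∀ᶠ q in 𝓝 p, ∃ᶠ q' in 𝓝 q, ∀ᶠ q'' in 𝓝 q',
      (q''.1 ^ 3 + q''.2 * q''.1 ^ 2 + q''.1) * y q'' ^ 2
        = x q'' ^ 3 + q''.2 * x q'' ^ 2 + x q'') :
    ∃ g : ℂ × ℂ → ℂ, AnalyticAt ℂ g p ∧
      ∀ᶠ q in 𝓝 p, ∃ᶠ q' in 𝓝 q, (fun q => partialZ x q / y q) =ᶠ[𝓝 q'] g := by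
  obtain ⟨a, b, ha, hb, hb0, hxab⟩ := hx
  obtain ⟨c, d, hc, hd, hd0, hycd⟩ := hy
  by_cases hc0 : ∃ᶠ q in 𝓝 p, c q ≠ 0
  swap
  · refine ⟨fun _ => 0, analyticAt_const, ?_⟩
    filter_upwards [hd.eventually_frequently_ne hd0, (not_frequently.1 hc0).eventually_nhds,
      hycd.eventually_nhds, hd.eventually_analyticAt.eventually_nhds] with q h1 h2 h3 h4
    refine (h1.and_eventually (h2.eventually_nhds.and
      (h3.eventually_nhds.and h4))).mono ?_
    rintro q' ⟨h5, h6, h7, h8⟩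
    filter_upwards [h6, h7, h8.continuousAt.eventually_ne h5] with w h9 h10 h11
    rw [h10 h11, not_not.1 h9]
    simp
  have hPa : AnalyticAt ℂ (fun q : ℂ × ℂ => q.1 ^ 3 + q.2 * q.1 ^ 2 + q.1) p :=
    ((analyticAt_fst.fun_pow 3).fun_add (analyticAt_snd.fun_mul (analyticAt_fst.fun_pow 2))).fun_add
      analyticAt_fst
  have hbd : AnalyticAt ℂ (fun q => b q * d q) p := hb.fun_mul hd
  have hrel : ∀ᶠ q in 𝓝 p, (q.1 ^ 3 + q.2 * q.1 ^ 2 + q.1) * c q ^ 2 * b q ^ 3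
      = d q ^ 2 * (a q * conic q.2 (a q) (b q)) := by
    refine eventually_eq_of_frequently_eq ((hPa.fun_mul (hc.fun_pow 2)).fun_mul (hb.fun_pow 3))
      ((hd.fun_pow 2).fun_mul (ha.fun_mul (analyticAt_conic analyticAt_snd ha hb))) ?_
    filter_upwards [h, hxab.eventually_nhds, hycd.eventually_nhds,
      (hbd.eventually_frequently_ne (hb.frequently_mul_ne hd hb0 hd0)).eventually_nhds]
      with q h1 h2 h3 h4
    rw [← frequently_frequently_nhds]
    refine (h1.and_eventually (h2.eventually_nhds.and (h3.eventually_nhds.and h4))).mono ?_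
    rintro q' ⟨h5, h6, h7, h8⟩
    refine (h8.and_eventually (h5.and (h6.and h7))).mono ?_
    rintro w ⟨hw, h9, h10, h11⟩
    have hbw := left_ne_zero_of_mul hw
    have hdw := right_ne_zero_of_mul hw
    rw [h10 hbw, h11 hdw] at h9
    unfold conic
    field_simp at h9
    linear_combination h9
  obtain ⟨g, hg, hgW⟩ := exists_eventually_wronskianZ_mul_eq hPa ha hb hc hd
    (frequently_cubic_ne_zero p) hb0 hc0 hrel
  refine ⟨g, hg, ?_⟩
  have hall : AnalyticAt ℂ (fun q => b q * d q * c q) p := hbd.fun_mul hc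
  filter_upwards [hall.eventually_frequently_ne
      (hbd.frequently_mul_ne hc (hb.frequently_mul_ne hd hb0 hd0) hc0),
    hgW.eventually_nhds, hxab.eventually_nhds, hycd.eventually_nhds,
    (hall.eventually_analyticAt.and (ha.eventually_analyticAt.and
      hb.eventually_analyticAt)).eventually_nhds] with q h1 h2 h3 h4 h5
  refine (h1.and_eventually (h2.eventually_nhds.and (h3.eventually_nhds.and
    (h4.eventually_nhds.and h5.eventually_nhds)))).mono ?_
  rintro q' ⟨hq', h6, h7, h8, h9⟩
  filter_upwards [h6, h7.eventually_nhds, h8, h9,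
    h9.self_of_nhds.1.continuousAt.eventually_ne hq'] with w k1 k2 k3 k4 k5
  obtain ⟨-, haw, hbw⟩ := k4
  have hcw := right_ne_zero_of_mul k5
  have hbw0 := left_ne_zero_of_mul (left_ne_zero_of_mul k5)
  have hdw0 := right_ne_zero_of_mul (left_ne_zero_of_mul k5)
  have hxw : x =ᶠ[𝓝 w] fun q => a q / b q := by
    filter_upwards [k2, hbw.continuousAt.eventually_ne hbw0] with v h1 h2 using h1 h2
  have e : partialZ x w = wronskianZ a b w / b w ^ 2 := by
    rw [partialZ_eq_of_eventuallyEq hxw]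
    exact ((hasDerivAt_partialZ haw).fun_div (hasDerivAt_partialZ hbw) hbw0).deriv
  rw [e, k3 hdw0]
  field_simp
  linear_combination k1

end ManinDenef

end

theorem lemma3p3 (B : Set (ℂ × ℂ)) (hB : IsConnected B)
    (hline : (Set.univ : Set ℂ) ×ˢ ({-2} : Set ℂ) ⊆ B)
    (x y : ManinDenef.FunGerm B) (hx : x ∈ ManinDenef.Mero B) (hy : y ∈ ManinDenef.Mero B)
    (hxy : (ManinDenef.zCoord B ^ 3 + ManinDenef.δCoord B * ManinDenef.zCoord B ^ 2
        + ManinDenef.zCoord B) * y ^ 2 = x ^ 3 + ManinDenef.δCoord B * x ^ 2 + x)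
    (hy0 : y ≠ 0) :
    ManinDenef.dz B x / y ∈ ManinDenef.Hol B := by
  obtain ⟨U, f, hU, hBU, hf, rfl⟩ := hx
  obtain ⟨V, g, hV, hBV, hg, rfl⟩ := hy
  have hrel : ∀ᶠ q : ℂ × ℂ in ManinDenef.genericNhds B,
      (q.1 ^ 3 + q.2 * q.1 ^ 2 + q.1) * g q ^ 2 = f q ^ 3 + q.2 * f q ^ 2 + f q :=
    Germ.coe_eq.1 hxy
  obtain ⟨T, D, hT, hBT, hD, hDS, hTD⟩ := hrel
  have hO : IsOpen (U ∩ V ∩ T) := (hU.inter hV).inter hT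
  obtain ⟨G, hG, hGf⟩ := ManinDenef.exists_analyticOnNhd_of_local hO
    (f := fun q => ManinDenef.partialZ f q / g q) (by
      rintro p ⟨⟨hpU, hpV⟩, hpT⟩
      refine ManinDenef.exists_analyticAt_eq_partialZ_div (hf p hpU) (hg p hpV) ?_
      filter_upwards [hT.mem_nhds hpT] with q hq
      refine (mem_closure_iff_frequently.1 (hTD hq)).mono fun q' hq' => ?_
      filter_upwards [hD.mem_nhds hq'] with w hw using hDS hw)
  have hBO : B ⊆ U ∩ V ∩ T := Set.subset_inter (Set.subset_inter hBU hBV) hBT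
  refine ⟨U ∩ V ∩ T, G, hO, hBO, hG, ?_⟩
  have hev : (fun q => ManinDenef.partialZ f q / g q) =ᶠ[ManinDenef.genericNhds B] G :=
    ⟨U ∩ V ∩ T, {q | (fun q => ManinDenef.partialZ f q / g q) =ᶠ[𝓝 q] G}, hO, hBO,
      isOpen_setOfPred_eventually_nhds, fun q hq => EventuallyEq.eq_of_nhds hq,
      fun q hq => mem_closure_iff_frequently.2 (hGf q hq)⟩
  exact Germ.coe_eq.2 hev
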